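/- Let $f\colon N\to M$ be a homomorphism of unital rings, $M$ regarded as an $N$-$N$-bimodule via $f$, that is a Frobenius extension: there are an $N$-$N$-bimodule map $\psi\colon M\to N$ and finitely many $u_i,v_i\in M$ with $\sum_i\psi(mu_i)v_i=m=\sum_iu_i\psi(v_im)$ for all $m\in M$; fix $\psi,u_i,v_i$. Put $A=\mathrm{End}({}_NM_N)$ (product: composition) and $B=\{X\in M\otimes_NM: nX=Xn\ \forall n\in N\}$. Assume the extension has depth $2$, i.e. there are finitely many $b_i\in B$, $\beta_i\in A$ with $\sum_i b_i^1\otimes b_i^2\beta_i(m)=m\otimes 1$ for all $m\in M$ or, equivalently, finitely many $c_i\in B$, $\gamma_i\in A$ with $\sum_i\gamma_i(m)c_i^1\otimes c_i^2=1\otimes m$ for all $m\in M$. Let $L=C_M(N)$ be the centralizer of $f(N)$ in $M$ and $R=L^{op}$. Let $\nu\colon L\to L$, $\nu(c)=\sum_i\psi(u_ic)v_i$, be the Nakayama automorphism, $\theta=\nu^{-1}\colon L\to R^{op}$ and $\iota=\mathrm{id}\colon R\to L^{op}$. For $c\in L$ put $\lambda(c)m=cm$ and $\rho(c)m=mc$.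 Set $$s_L=\lambda\colon L\to A,\quad t_L=\rho\colon L^{op}\to A,\quad \pi_L(\alpha)=\alpha(1),$$ $$s_R=\rho\colon R\to A,\quad t_R=\lambda\circ\nu\colon R^{op}\to A,\quad \pi_R(\alpha)=\sum_iu_i\psi(\alpha(v_i)).$$ Let $A\otimes_LA$ be formed with respect to the bimodule structure $l\cdot\alpha\cdot l'=s_L(l)t_L(l')\alpha$, and $A\otimes_RA$ with respect to $r\cdot\alpha\cdot r'=\alpha\, s_R(r')t_R(r)$. Define $S_A\colon A\to A$ by $S_A(\alpha)(m)=\sum_iu_i\psi(\alpha(v_i)m)$. Then: 1. For each $\alpha\in A$ there is a unique $\gamma_L(\alpha)=\alpha_{(1)}\otimes\alpha_{(2)}\in A\otimes_LA$ with $\alpha(mm')=\alpha_{(1)}(m)\alpha_{(2)}(m')$ for all $m,m'\in M$, and a unique $\gamma_R(\alpha)=\alpha^{(1)}\otimes\alpha^{(2)}\in A\otimes_RA$ with $\sum_i\alpha(m)u_i\otimes v_i=\sum_i\alpha^{(1)}(mu_i)\otimes\alpha^{(2)}(v_i)$ in $M\otimes_NM$ for all $m\in M$. The maps $\gamma_L,\gamma_R$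 are additive. 2. $\mathcal A_L=(A,L,s_L,t_L,\gamma_L,\pi_L)$ is a left bialgebroid and $\mathcal A_R=(A,R,s_R,t_R,\gamma_R,\pi_R)$ is a right bialgebroid. 3. $S_A$ is a ring isomorphism $A\to A^{op}$, it is the transposition $\psi(m\,S_A(\alpha)(m'))=\psi(\alpha(m)m')$, and $$(S_A,\iota)\colon\mathcal A_R\to(\mathcal A_L)^{op}_{cop},\qquad (S_A,\theta)\colon\mathcal A_L\to(\mathcal A_R)^{op}_{cop}$$ are isomorphisms of right, respectively left, bialgebroids. Here a left bialgebroid $(A,L,s,t,\gamma,\pi)$ consists of ring homomorphisms $s\colon L\to A$, $t\colon L^{op}\to A$ with commuting images and a comonoid $(A,\gamma,\pi)$ in the category of $L$-$L$-bimodules, for $l\cdot a\cdot l'=s(l)t(l')a$, such that, with $\gamma(a)=a_{(1)}\otimes a_{(2)}$, one has $a_{(1)}t(l)\otimes a_{(2)}=a_{(1)}\otimes a_{(2)}s(l)$, $\gamma(1)=1\otimes1$, $\gamma(ab)=\gamma(a)\gamma(b)$, $\pi(1)=1$ and $\pi(a\,s(\pi(b)))=\pi(ab)=\pi(a\,t(\pi(b)))$.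 A right bialgebroid $(A,R,s,t,\gamma,\pi)$ is the same with the bimodule structure $r\cdot a\cdot r'=a\,s(r')t(r)$ and the conditions $s(r)a^{(1)}\otimes a^{(2)}=a^{(1)}\otimes t(r)a^{(2)}$, $\gamma(1)=1\otimes1$, $\gamma(ab)=\gamma(a)\gamma(b)$, $\pi(1)=1$ and $\pi(s(\pi(a))b)=\pi(ab)=\pi(t(\pi(a))b)$. The opposite of $(A,L,s,t,\gamma,\pi)$ is $(A^{op},L,t,s,\gamma,\pi)$; it exchanges left and right bialgebroids. The co-opposite is $(A,L^{op},t,s,\gamma^{op},\pi)$, where $\gamma^{op}$ is $\gamma$ followed by the flip. An isomorphism of left (or of right) bialgebroids is a pair of ring isomorphisms $(\Phi,\phi)$ of the total and base rings with $s'\phi=\Phi s$, $t'\phi=\Phi t$, $\pi'\Phi=\phi\pi$ and $\gamma'\Phi=(\Phi\otimes\Phi)\gamma$. -/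

import Mathlib

open MulOpposite

open scoped TensorProduct

universe u v

/-! Bimodules over a (noncommutative) ring and their tensor products. -/

/-- An `L`-`L`-bimodule structure on the additive group `X`: commuting unital left and right
actions, `P.l a x = a · x` and `P.r (op a) x = x · a`. -/
structure BimodStr (L : Type*) (X : Type*) [Ring L] [AddCommGroup X] where
  l : L →+* AddMonoid.End X
  r : Lᵐᵒᵖ →+* AddMonoid.End X
  comm : ∀ a b x, l a (r b x) = r b (l a x)

section Tensor

variable {L X Y Z : Type*} [Ring L] [AddCommGroup X] [AddCommGroup Y] [AddCommGroup Z]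

/-- The subgroup of `X ⊗_ℤ Y` generated by all `x · a ⊗ y - x ⊗ a · y`. -/
def balancedRel (P : BimodStr L X) (Q : BimodStr L Y) : AddSubgroup (X ⊗[ℤ] Y) :=
  AddSubgroup.closure {z | ∃ x a y, z = (P.r (op a) x) ⊗ₜ[ℤ] y - x ⊗ₜ[ℤ] (Q.l a y)}

/-- The tensor product `X ⊗_L Y` of two `L`-`L`-bimodules. -/
def BTensor (P : BimodStr L X) (Q : BimodStr L Y) := (X ⊗[ℤ] Y) ⧸ balancedRel P Q

namespace BTensor

instance (P : BimodStr L X) (Q : BimodStr L Y) : AddCommGroup (BTensor P Q) :=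
  inferInstanceAs (AddCommGroup ((X ⊗[ℤ] Y) ⧸ balancedRel P Q))

/-- The pure tensor `x ⊗ y`. -/
def tmul (P : BimodStr L X) (Q : BimodStr L Y) (x : X) (y : Y) : BTensor P Q :=
  QuotientAddGroup.mk (s := balancedRel P Q) (x ⊗ₜ[ℤ] y)

variable {P : BimodStr L X} {Q : BimodStr L Y}

theorem tmul_add (x : X) (y y' : Y) :
    tmul P Q x (y + y') = tmul P Q x y + tmul P Q x y' :=
  congrArg (QuotientAddGroup.mk (s := balancedRel P Q)) (TensorProduct.tmul_add x y y')

theorem add_tmul (x x' : X) (y : Y) :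
    tmul P Q (x + x') y = tmul P Q x y + tmul P Q x' y :=
  congrArg (QuotientAddGroup.mk (s := balancedRel P Q)) (TensorProduct.add_tmul x x' y)

theorem balanced (x : X) (a : L) (y : Y) :
    tmul P Q (P.r (op a) x) y = tmul P Q x (Q.l a y) := by
  refine QuotientAddGroup.eq_iff_sub_mem.mpr (AddSubgroup.subset_closure ⟨x, a, y, rfl⟩)

theorem induction {p : BTensor P Q → Prop} (T : BTensor P Q) (h0 : p 0)
    (ht : ∀ x y, p (tmul P Q x y)) (ha : ∀ S T, p S → p T → p (S + T)) : p T := by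
  refine QuotientAddGroup.induction_on T (fun z => ?_)
  induction z using TensorProduct.induction_on with
  | zero => exact h0
  | tmul x y => exact ht x y
  | add z w hz hw => exact ha _ _ hz hw

/-- The universal property: a biadditive `L`-balanced map factors through `X ⊗_L Y`. -/
def lift (φ : X →+ Y →+ Z) (h : ∀ x a y, φ (P.r (op a) x) y = φ x (Q.l a y)) :
    BTensor P Q →+ Z :=
  QuotientAddGroup.lift (balancedRel P Q)
    (TensorProduct.liftAddHom φ (fun n x y => by simp))
    (by
      refine (AddSubgroup.closure_le _).mpr ?_
      rintro _ ⟨x, a, y, rfl⟩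
      have := h x a y
      simp [this])

@[simp] theorem lift_tmul (φ : X →+ Y →+ Z)
    (h : ∀ x a y, φ (P.r (op a) x) y = φ x (Q.l a y)) (x : X) (y : Y) :
    lift φ h (tmul P Q x y) = φ x y := rfl

theorem hom_ext {g g' : BTensor P Q →+ Z} (h : ∀ x y, g (tmul P Q x y) = g' (tmul P Q x y)) :
    g = g' := by
  ext T
  induction T using BTensor.induction with
  | h0 => simp
  | ht x y => exact h x y
  | ha S T hS hT => simp [hS, hT]

/-- The biadditive map `(x, y) ↦ x ⊗ y`. -/
def tmulHom (P : BimodStr L X) (Q : BimodStr L Y) : X →+ Y →+ BTensor P Q :=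
  AddMonoidHom.mk' (fun x => AddMonoidHom.mk' (tmul P Q x) (tmul_add x))
    (fun x x' => by ext y; exact add_tmul x x' y)

@[simp] theorem tmulHom_apply (x : X) (y : Y) : tmulHom P Q x y = tmul P Q x y := rfl

variable {X' Y' : Type*} [AddCommGroup X'] [AddCommGroup Y'] {P' : BimodStr L X'} {Q' : BimodStr L Y'}

/-- `g ⊗ h` for a right `L`-linear `g` and a left `L`-linear `h`. -/
def map (g : X →+ X') (h : Y →+ Y')
    (hg : ∀ a x, g (P.r (op a) x) = P'.r (op a) (g x))
    (hh : ∀ a y, h (Q.l a y) = Q'.l a (h y)) : BTensor P Q →+ BTensor P' Q' :=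
  lift (((tmulHom P' Q').comp g).compl₂ h)
    (fun x a y => by simp [hg, hh, balanced])

@[simp] theorem map_tmul (g : X →+ X') (h : Y →+ Y')
    (hg : ∀ a x, g (P.r (op a) x) = P'.r (op a) (g x))
    (hh : ∀ a y, h (Q.l a y) = Q'.l a (h y)) (x : X) (y : Y) :
    map g h hg hh (tmul P Q x y) = tmul P' Q' (g x) (h y) := rfl

end BTensor

/-- The bimodule structure `a · (x ⊗ y) · b = (a · x) ⊗ (y · b)` on `X ⊗_L Y`. -/
def BimodStr.tensor (P : BimodStr L X) (Q : BimodStr L Y) : BimodStr L (BTensor P Q) where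
  l :=
    { toFun := fun a => BTensor.map (P.l a) (AddMonoidHom.id Y)
        (by exact fun b x => P.comm a (op b) x) (by intros; refine Eq.trans ?_ rfl; rfl)
      map_one' := BTensor.hom_ext fun x y => by
        change BTensor.tmul P Q (P.l 1 x) y = BTensor.tmul P Q x y
        simp
      map_mul' := fun a b => BTensor.hom_ext fun x y => by
        change BTensor.tmul P Q (P.l (a * b) x) y = BTensor.tmul P Q (P.l a (P.l b x)) y
        simp
      map_zero' := BTensor.hom_ext fun x y => by
        change (BTensor.tmulHom P Q) (P.l 0 x) y = 0
        simp only [map_zero, AddMonoid.End.zero_apply, AddMonoidHom.zero_apply]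
      map_add' := fun a b => BTensor.hom_ext fun x y => by
        change BTensor.tmul P Q (P.l (a + b) x) y =
          BTensor.tmul P Q (P.l a x) y + BTensor.tmul P Q (P.l b x) y
        rw [map_add, ← BTensor.add_tmul]; rfl }
  r :=
    { toFun := fun b => BTensor.map (AddMonoidHom.id X) (Q.r b)
        (by intros; refine Eq.trans ?_ rfl; rfl) (by exact fun a y => (Q.comm a b y).symm)
      map_one' := BTensor.hom_ext fun x y => by
        change BTensor.tmul P Q x (Q.r 1 y) = BTensor.tmul P Q x y
        simp
      map_mul' := fun a b => BTensor.hom_ext fun x y => by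
        change BTensor.tmul P Q x (Q.r (a * b) y) = BTensor.tmul P Q x (Q.r a (Q.r b y))
        simp
      map_zero' := BTensor.hom_ext fun x y => by
        change (BTensor.tmulHom P Q) x (Q.r 0 y) = 0
        simp only [map_zero, AddMonoid.End.zero_apply]
      map_add' := fun a b => BTensor.hom_ext fun x y => by
        change BTensor.tmul P Q x (Q.r (a + b) y) =
          BTensor.tmul P Q x (Q.r a y) + BTensor.tmul P Q x (Q.r b y)
        rw [map_add, ← BTensor.tmul_add]; rfl }
  comm := fun a b T => by
    induction T using BTensor.induction with
    | h0 => simp only [map_zero]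
    | ht x y => rfl
    | ha S T hS hT => simp only [map_add, hS, hT]

/-- The associativity isomorphism `(X ⊗_L Y) ⊗_L Z → X ⊗_L (Y ⊗_L Z)`. -/
def BTensor.assoc (P : BimodStr L X) (Q : BimodStr L Y) (W : BimodStr L Z) :
    BTensor (P.tensor Q) W →+ BTensor P (Q.tensor W) :=
  BTensor.lift
    (BTensor.lift
      (AddMonoidHom.mk' (fun x => (BTensor.tmulHom Q W).compr₂ (BTensor.tmulHom P (Q.tensor W) x))
        (fun x x' => by ext y z; simp))
      (by intro x a y; ext z; exact BTensor.balanced x a (BTensor.tmul Q W y z)))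
    (fun T a z => by
      induction T using BTensor.induction with
      | h0 => simp
      | ht x y =>
        exact congrArg (BTensor.tmul P (Q.tensor W) x) (BTensor.balanced y a z)
      | ha S T hS hT => simp only [map_add, AddMonoidHom.add_apply, hS, hT])

/-- `(X, γ, π)` is a comonoid in the monoidal category of `L`-`L`-bimodules. -/
structure IsComonoid (P : BimodStr L X) (γ : X →+ BTensor P P) (π : X →+ L) : Prop where
  comul_left : ∀ a x, γ (P.l a x) = (P.tensor P).l a (γ x)
  comul_right : ∀ a x, γ (P.r (op a) x) = (P.tensor P).r (op a) (γ x)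
  counit_left : ∀ a x, π (P.l a x) = a * π x
  counit_right : ∀ a x, π (P.r (op a) x) = π x * a
  /-- `(γ ⊗ id) ∘ γ = (id ⊗ γ) ∘ γ` -/
  coassoc : ∀ x,
    BTensor.assoc P P P
        (BTensor.map (P' := P.tensor P) (Q' := P) γ (AddMonoidHom.id X)
          comul_right (by intros; refine Eq.trans ?_ rfl; rfl) (γ x)) =
      BTensor.map (P' := P) (Q' := P.tensor P) (AddMonoidHom.id X) γ
        (by intros; refine Eq.trans ?_ rfl; rfl) comul_left (γ x)
  /-- `π(x₁) · x₂ = x` -/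
  counit_comul : ∀ x,
    BTensor.lift (P := P) (Q := P)
      ((AddMonoidHom.id (AddMonoid.End X) : AddMonoid.End X →+ (X →+ X)).comp
        ((P.l : L →+ AddMonoid.End X).comp π))
      (by
        intro y a z
        refine Eq.trans ?_ rfl
        change P.l (π (P.r (op a) y)) z = P.l (π y) (P.l a z)
        simp [counit_right]) (γ x) = x
  /-- `x₁ · π(x₂) = x` -/
  comul_counit : ∀ x,
    BTensor.lift (P := P) (Q := P)
      (((AddMonoidHom.id (AddMonoid.End X) : AddMonoid.End X →+ (X →+ X)).comp
        ((P.r : Lᵐᵒᵖ →+ AddMonoid.End X).comp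
          ((opAddEquiv : L ≃+ Lᵐᵒᵖ).toAddMonoidHom.comp π))).flip)
      (by
        intro y a z
        refine Eq.trans ?_ rfl
        change P.r (op (π z)) (P.r (op a) y) = P.r (op (π (P.l a z))) y
        simp [counit_left]) (γ x) = x

end Tensor

/-! Left and right bialgebroids. -/

/-- Source and target maps: ring homomorphisms `s : L → A` and `t : L^op → A` with
commuting images. -/
structure SourceTarget (A : Type*) (L : Type*) [Ring A] [Ring L] where
  s : L →+* A
  t : Lᵐᵒᵖ →+* A
  comm : ∀ a b, s a * t b = t b * s a

section Bialgebroid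

variable {A L : Type*} [Ring A] [Ring L]

namespace SourceTarget

variable (D : SourceTarget A L)

/-- The bimodule `_L A_L` of a left bialgebroid: `l · a · l' = s(l) t(l') a`. -/
def bimodL : BimodStr L A where
  l := (Module.toAddMonoidEnd A A).comp D.s
  r := (Module.toAddMonoidEnd A A).comp D.t
  comm := fun a b x => by
    change D.s a * (D.t b * x) = D.t b * (D.s a * x)
    rw [← mul_assoc, ← mul_assoc, D.comm]

@[simp] theorem bimodL_l_apply (l : L) (a : A) : D.bimodL.l l a = D.s l * a := rfl

@[simp] theorem bimodL_r_apply (l : Lᵐᵒᵖ) (a : A) : D.bimodL.r l a = D.t l * a := rfl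

/-- The target map as a ring homomorphism `L → A^op`. -/
def tOp : L →+* Aᵐᵒᵖ :=
  (RingHom.op D.t).comp (RingEquiv.opOp L).toRingHom

/-- The bimodule `^R A^R` of a right bialgebroid: `r · a · r' = a s(r') t(r)`. -/
def bimodR : BimodStr L A where
  l := (Module.toAddMonoidEnd Aᵐᵒᵖ A).comp D.tOp
  r := (Module.toAddMonoidEnd Aᵐᵒᵖ A).comp (RingHom.op D.s)
  comm := fun a b x => by
    change x * D.s (unop b) * D.t (op a) = x * D.t (op a) * D.s (unop b)
    rw [mul_assoc, mul_assoc, D.comm]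

@[simp] theorem bimodR_l_apply (r : L) (a : A) : D.bimodR.l r a = a * D.t (op r) := rfl

@[simp] theorem bimodR_r_apply (r : Lᵐᵒᵖ) (a : A) : D.bimodR.r r a = a * D.s (unop r) := rfl

/-- The same ring homomorphisms, with values in `A^op`: `s^op = t` and `t^op = s`. -/
def opp : SourceTarget Aᵐᵒᵖ L where
  s := D.tOp
  t := RingHom.op D.s
  comm := fun a b => by
    change op (D.t (op a)) * op (D.s (unop b)) = op (D.s (unop b)) * op (D.t (op a))
    rw [← op_mul, ← op_mul, D.comm]

/-- The same ring homomorphisms, over `L^op`: `s_cop = t` and `t_cop = s`. -/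
def cop : SourceTarget A Lᵐᵒᵖ where
  s := D.t
  t := D.s.comp (RingEquiv.opOp L).symm.toRingHom
  comm := fun a b => (D.comm (unop (unop b)) a).symm

end SourceTarget

variable (A L) in
/-- The data `(A, L, s, t, γ, π)` of a left bialgebroid, `γ : A → A_L ⊗ _L A`. -/
structure LeftBgdData extends SourceTarget A L where
  comul : A →+ BTensor toSourceTarget.bimodL toSourceTarget.bimodL
  counit : A →+ L

variable (A L) in
/-- The data `(A, R, s, t, γ, π)` of a right bialgebroid, `γ : A → A^R ⊗ ^R A`. -/
structure RightBgdData extends SourceTarget A L where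
  comul : A →+ BTensor toSourceTarget.bimodR toSourceTarget.bimodR
  counit : A →+ L

namespace SourceTarget

variable (D : SourceTarget A L)

/-- `a ⊗ b ↦ a x ⊗ b y` on `A_L ⊗ _L A`. -/
def rightMul (x y : A) : BTensor D.bimodL D.bimodL →+ BTensor D.bimodL D.bimodL :=
  BTensor.map (AddMonoidHom.mulRight x) (AddMonoidHom.mulRight y)
    (by intros; refine Eq.trans ?_ rfl; simp [mul_assoc])
    (by intros; refine Eq.trans ?_ rfl; simp [mul_assoc])

/-- `a ⊗ b ↦ x a ⊗ y b` on `A^R ⊗ ^R A`. -/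
def leftMul (x y : A) : BTensor D.bimodR D.bimodR →+ BTensor D.bimodR D.bimodR :=
  BTensor.map (AddMonoidHom.mulLeft x) (AddMonoidHom.mulLeft y)
    (by intros; refine Eq.trans ?_ rfl; simp [mul_assoc])
    (by intros; refine Eq.trans ?_ rfl; simp [mul_assoc])

@[simp] theorem rightMul_tmul (x y a b : A) :
    D.rightMul x y (BTensor.tmul D.bimodL D.bimodL a b) =
      BTensor.tmul D.bimodL D.bimodL (a * x) (b * y) := rfl

@[simp] theorem leftMul_tmul (x y a b : A) :
    D.leftMul x y (BTensor.tmul D.bimodR D.bimodR a b) =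
      BTensor.tmul D.bimodR D.bimodR (x * a) (y * b) := rfl

theorem rightMul_add_left (x x' y : A) (T : BTensor D.bimodL D.bimodL) :
    D.rightMul (x + x') y T = D.rightMul x y T + D.rightMul x' y T := by
  induction T using BTensor.induction with
  | h0 => simp
  | ht a b => simp [mul_add, BTensor.add_tmul]
  | ha S T hS hT => simp only [map_add, hS, hT]; abel

theorem rightMul_add_right (x y y' : A) (T : BTensor D.bimodL D.bimodL) :
    D.rightMul x (y + y') T = D.rightMul x y T + D.rightMul x y' T := by
  induction T using BTensor.induction with
  | h0 => simp
  | ht a b => simp [mul_add, BTensor.tmul_add]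
  | ha S T hS hT => simp only [map_add, hS, hT]; abel

theorem rightMul_rightMul (x x' y y' : A) (T : BTensor D.bimodL D.bimodL) :
    D.rightMul x' y' (D.rightMul x y T) = D.rightMul (x * x') (y * y') T := by
  induction T using BTensor.induction with
  | h0 => simp
  | ht a b => simp [mul_assoc]
  | ha S T hS hT => simp only [map_add, hS, hT]

theorem leftMul_add_left (x x' y : A) (T : BTensor D.bimodR D.bimodR) :
    D.leftMul (x + x') y T = D.leftMul x y T + D.leftMul x' y T := by
  induction T using BTensor.induction with
  | h0 => simp
  | ht a b => simp [add_mul, BTensor.add_tmul]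
  | ha S T hS hT => simp only [map_add, hS, hT]; abel

theorem leftMul_add_right (x y y' : A) (T : BTensor D.bimodR D.bimodR) :
    D.leftMul x (y + y') T = D.leftMul x y T + D.leftMul x y' T := by
  induction T using BTensor.induction with
  | h0 => simp
  | ht a b => simp [add_mul, BTensor.tmul_add]
  | ha S T hS hT => simp only [map_add, hS, hT]; abel

theorem leftMul_leftMul (x x' y y' : A) (T : BTensor D.bimodR D.bimodR) :
    D.leftMul x y (D.leftMul x' y' T) = D.leftMul (x * x') (y * y') T := by
  induction T using BTensor.induction with
  | h0 => simp
  | ht a b => simp [mul_assoc]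
  | ha S T hS hT => simp only [map_add, hS, hT]

/-- The map `T' ↦ T T'`, `(a ⊗ b)(c ⊗ d) = a c ⊗ b d`, on `A_L ⊗ _L A`. It is well defined
when `T = a₁ ⊗ a₂` satisfies `a₁ t(l) ⊗ a₂ = a₁ ⊗ a₂ s(l)` for all `l`. -/
def tensorMulL (T : BTensor D.bimodL D.bimodL)
    (hT : ∀ l : L, D.rightMul (D.t (op l)) 1 T = D.rightMul 1 (D.s l) T) :
    BTensor D.bimodL D.bimodL →+ BTensor D.bimodL D.bimodL :=
  BTensor.lift
    (AddMonoidHom.mk' (fun x => AddMonoidHom.mk' (fun y => D.rightMul x y T)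
        (fun y y' => D.rightMul_add_right x y y' T))
      (fun x x' => by ext y; exact D.rightMul_add_left x x' y T))
    (fun x l y => by
      have h := congrArg (D.rightMul x y) (hT l)
      simpa [rightMul_rightMul] using h)

/-- The map `T' ↦ T' T`, `(a ⊗ b)(c ⊗ d) = a c ⊗ b d`, on `A^R ⊗ ^R A`. It is well defined
when `T = a¹ ⊗ a²` satisfies `s(r) a¹ ⊗ a² = a¹ ⊗ t(r) a²` for all `r`. -/
def tensorMulR (T : BTensor D.bimodR D.bimodR)
    (hT : ∀ r : L, D.leftMul (D.s r) 1 T = D.leftMul 1 (D.t (op r)) T) :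
    BTensor D.bimodR D.bimodR →+ BTensor D.bimodR D.bimodR :=
  BTensor.lift
    (AddMonoidHom.mk' (fun x => AddMonoidHom.mk' (fun y => D.leftMul x y T)
        (fun y y' => D.leftMul_add_right x y y' T))
      (fun x x' => by ext y; exact D.leftMul_add_left x x' y T))
    (fun x r y => by
      have h := congrArg (D.leftMul x y) (hT r)
      simpa [leftMul_leftMul] using h)

end SourceTarget

/-- The axioms of a left bialgebroid. -/
structure IsLeftBialgebroid (D : LeftBgdData A L) : Prop where
  comonoid : IsComonoid D.bimodL D.comul D.counit
  /-- `a₁ t(l) ⊗ a₂ = a₁ ⊗ a₂ s(l)` -/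
  takeuchi : ∀ a, ∀ l : L,
    D.rightMul (D.t (op l)) 1 (D.comul a) = D.rightMul 1 (D.s l) (D.comul a)
  comul_one : D.comul 1 = BTensor.tmul D.bimodL D.bimodL 1 1
  /-- `γ(a b) = γ(a) γ(b)` -/
  comul_mul : ∀ a b, D.comul (a * b) = D.tensorMulL (D.comul a) (takeuchi a) (D.comul b)
  counit_one : D.counit 1 = 1
  counit_mul_s : ∀ a b, D.counit (a * D.s (D.counit b)) = D.counit (a * b)
  counit_mul_t : ∀ a b, D.counit (a * D.t (op (D.counit b))) = D.counit (a * b)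

/-- The axioms of a right bialgebroid. -/
structure IsRightBialgebroid (D : RightBgdData A L) : Prop where
  comonoid : IsComonoid D.bimodR D.comul D.counit
  /-- `s(r) a¹ ⊗ a² = a¹ ⊗ t(r) a²` -/
  takeuchi : ∀ a, ∀ r : L,
    D.leftMul (D.s r) 1 (D.comul a) = D.leftMul 1 (D.t (op r)) (D.comul a)
  comul_one : D.comul 1 = BTensor.tmul D.bimodR D.bimodR 1 1
  /-- `γ(a b) = γ(a) γ(b)` -/
  comul_mul : ∀ a b, D.comul (a * b) = D.tensorMulR (D.comul b) (takeuchi b) (D.comul a)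
  counit_one : D.counit 1 = 1
  counit_s_mul : ∀ a b, D.counit (D.s (D.counit a) * b) = D.counit (a * b)
  counit_t_mul : ∀ a b, D.counit (D.t (op (D.counit a)) * b) = D.counit (a * b)

/-- The co-opposite `(A, L^op, t, s, γ^op, π)` of `(A, L, s, t, γ, π)`. -/
def LeftBgdData.cop (D : LeftBgdData A L) : LeftBgdData A Lᵐᵒᵖ where
  toSourceTarget := D.toSourceTarget.cop
  comul :=
    (BTensor.lift (P := D.bimodL) (Q := D.bimodL)
      (BTensor.tmulHom D.toSourceTarget.cop.bimodL D.toSourceTarget.cop.bimodL).flip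
      (by
        intro x l y
        refine Eq.trans ?_ rfl
        exact (BTensor.balanced (P := D.toSourceTarget.cop.bimodL) (Q := D.toSourceTarget.cop.bimodL)
          y (op l) x).symm)).comp D.comul
  counit := (opAddEquiv : L ≃+ Lᵐᵒᵖ).toAddMonoidHom.comp D.counit

/-- The opposite `(A^op, L, t, s, γ, π)` of `(A, L, s, t, γ, π)`, with the data of a right
bialgebroid. -/
def LeftBgdData.opp (D : LeftBgdData A L) : RightBgdData Aᵐᵒᵖ L where
  toSourceTarget := D.toSourceTarget.opp
  comul :=
    ((BTensor.lift (P := D.bimodL) (Q := D.bimodL)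
      (((BTensor.tmulHom D.toSourceTarget.opp.bimodR D.toSourceTarget.opp.bimodR).comp
        (opAddEquiv : A ≃+ Aᵐᵒᵖ).toAddMonoidHom).compl₂ (opAddEquiv : A ≃+ Aᵐᵒᵖ).toAddMonoidHom)
      (by
        intro x l y
        refine Eq.trans ?_ rfl
        exact BTensor.balanced (P := D.toSourceTarget.opp.bimodR) (Q := D.toSourceTarget.opp.bimodR)
          (op x) l (op y))).comp D.comul).comp (opAddEquiv : A ≃+ Aᵐᵒᵖ).symm.toAddMonoidHom
  counit := D.counit.comp (opAddEquiv : A ≃+ Aᵐᵒᵖ).symm.toAddMonoidHom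

/-- The opposite `(A^op, R, t, s, γ, π)` of `(A, R, s, t, γ, π)`, with the data of a left
bialgebroid. -/
def RightBgdData.opp (D : RightBgdData A L) : LeftBgdData Aᵐᵒᵖ L where
  toSourceTarget := D.toSourceTarget.opp
  comul :=
    ((BTensor.lift (P := D.bimodR) (Q := D.bimodR)
      (((BTensor.tmulHom D.toSourceTarget.opp.bimodL D.toSourceTarget.opp.bimodL).comp
        (opAddEquiv : A ≃+ Aᵐᵒᵖ).toAddMonoidHom).compl₂ (opAddEquiv : A ≃+ Aᵐᵒᵖ).toAddMonoidHom)
      (by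
        intro x l y
        refine Eq.trans ?_ rfl
        exact BTensor.balanced (P := D.toSourceTarget.opp.bimodL) (Q := D.toSourceTarget.opp.bimodL)
          (op x) l (op y))).comp D.comul).comp (opAddEquiv : A ≃+ Aᵐᵒᵖ).symm.toAddMonoidHom
  counit := D.counit.comp (opAddEquiv : A ≃+ Aᵐᵒᵖ).symm.toAddMonoidHom

section Hom

variable {A' L' : Type*} [Ring A'] [Ring L']

/-- `Φ ⊗ Φ : A_L ⊗ _L A → A'_L' ⊗ _L' A'`. -/
def tensorHomL (D : SourceTarget A L) (D' : SourceTarget A' L') (Φ : A →+* A') (φ : L →+* L')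
    (hs : ∀ l, D'.s (φ l) = Φ (D.s l)) (ht : ∀ l, D'.t (op (φ l)) = Φ (D.t (op l))) :
    BTensor D.bimodL D.bimodL →+ BTensor D'.bimodL D'.bimodL :=
  BTensor.lift
    (((BTensor.tmulHom D'.bimodL D'.bimodL).comp Φ.toAddMonoidHom).compl₂ Φ.toAddMonoidHom)
    (by
      intro x l y
      refine Eq.trans ?_ rfl
      change BTensor.tmul _ _ (Φ (D.t (op l) * x)) (Φ y) =
        BTensor.tmul _ _ (Φ x) (Φ (D.s l * y))
      rw [map_mul, map_mul, ← hs, ← ht]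
      exact BTensor.balanced (P := D'.bimodL) (Q := D'.bimodL) (Φ x) (φ l) (Φ y))

/-- `Φ ⊗ Φ : A^R ⊗ ^R A → A'^R' ⊗ ^R' A'`. -/
def tensorHomR (D : SourceTarget A L) (D' : SourceTarget A' L') (Φ : A →+* A') (φ : L →+* L')
    (hs : ∀ l, D'.s (φ l) = Φ (D.s l)) (ht : ∀ l, D'.t (op (φ l)) = Φ (D.t (op l))) :
    BTensor D.bimodR D.bimodR →+ BTensor D'.bimodR D'.bimodR :=
  BTensor.lift
    (((BTensor.tmulHom D'.bimodR D'.bimodR).comp Φ.toAddMonoidHom).compl₂ Φ.toAddMonoidHom)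
    (by
      intro x l y
      refine Eq.trans ?_ rfl
      change BTensor.tmul _ _ (Φ (x * D.s l)) (Φ y) =
        BTensor.tmul _ _ (Φ x) (Φ (y * D.t (op l)))
      rw [map_mul, map_mul, ← hs, ← ht]
      exact BTensor.balanced (P := D'.bimodR) (Q := D'.bimodR) (Φ x) (φ l) (Φ y))

/-- `(Φ, φ)` is an isomorphism of left bialgebroids. -/
structure IsLeftBialgebroidIso (D : LeftBgdData A L) (D' : LeftBgdData A' L')
    (Φ : A →+* A') (φ : L →+* L') : Prop where
  source : IsLeftBialgebroid D
  target : IsLeftBialgebroid D'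
  s_comp : ∀ l, D'.s (φ l) = Φ (D.s l)
  t_comp : ∀ l, D'.t (op (φ l)) = Φ (D.t (op l))
  counit_comp : ∀ a, D'.counit (Φ a) = φ (D.counit a)
  comul_comp : ∀ a, D'.comul (Φ a) =
    tensorHomL D.toSourceTarget D'.toSourceTarget Φ φ s_comp t_comp (D.comul a)
  bijective_total : Function.Bijective Φ
  bijective_base : Function.Bijective φ

/-- `(Φ, φ)` is an isomorphism of right bialgebroids. -/
structure IsRightBialgebroidIso (D : RightBgdData A L) (D' : RightBgdData A' L')
    (Φ : A →+* A') (φ : L →+* L') : Prop where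
  source : IsRightBialgebroid D
  target : IsRightBialgebroid D'
  s_comp : ∀ l, D'.s (φ l) = Φ (D.s l)
  t_comp : ∀ l, D'.t (op (φ l)) = Φ (D.t (op l))
  counit_comp : ∀ a, D'.counit (Φ a) = φ (D.counit a)
  comul_comp : ∀ a, D'.comul (Φ a) =
    tensorHomR D.toSourceTarget D'.toSourceTarget Φ φ s_comp t_comp (D.comul a)
  bijective_total : Function.Bijective Φ
  bijective_base : Function.Bijective φ

end Hom

end Bialgebroid

/-! Frobenius extensions, depth two, and the endomorphism ring `End _N M_N`. -/

section Extension

variable {N : Type u} {M : Type v} [Ring N] [Ring M] (f : N →+* M)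

/-- `M` as an `N`-`N`-bimodule along `f : N → M`. -/
def extBimod : BimodStr N M where
  l := (Module.toAddMonoidEnd M M).comp f
  r := (Module.toAddMonoidEnd Mᵐᵒᵖ M).comp (RingHom.op f)
  comm := fun a b x => (mul_assoc (f a) x (f (unop b))).symm

@[simp] theorem extBimod_l_apply (n : N) (m : M) : (extBimod f).l n m = f n * m := rfl

@[simp] theorem extBimod_r_apply (n : Nᵐᵒᵖ) (m : M) :
    (extBimod f).r n m = m * f (unop n) := rfl

/-- `M ⊗_N M`. -/
abbrev ExtTensor := BTensor (extBimod f) (extBimod f)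

/-- The ring `A = End _N M_N` of `N`-`N`-bimodule endomorphisms of `M`, under composition. -/
def bimodEnd : Subring (AddMonoid.End M) where
  carrier := {α | (∀ n m, α (f n * m) = f n * α m) ∧ ∀ n m, α (m * f n) = α m * f n}
  mul_mem' := fun ha hb => by
    refine ⟨fun n m => ?_, fun n m => ?_⟩
    · exact (congrArg _ (hb.1 n m)).trans (ha.1 n _)
    · exact (congrArg _ (hb.2 n m)).trans (ha.2 n _)
  one_mem' := by constructor <;> intros <;> rfl
  add_mem' := fun {a b} ha hb => by
    refine ⟨fun n m => ?_, fun n m => ?_⟩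
    · change a _ + b _ = _ * (a _ + b _)
      rw [ha.1, hb.1, mul_add]
    · change a _ + b _ = (a _ + b _) * _
      rw [ha.2, hb.2, add_mul]
  zero_mem' := by
    refine ⟨fun n m => ?_, fun n m => ?_⟩
    · change (0 : M) = f n * 0
      simp
    · change (0 : M) = 0 * f n
      simp
  neg_mem' := fun {a} ha => by
    refine ⟨fun n m => ?_, fun n m => ?_⟩
    · change -a _ = _ * -a _
      rw [ha.1, mul_neg]
    · change -a _ = -a _ * _
      rw [ha.2, neg_mul]

/-- The centralizer `L = C_M(N)`. -/
abbrev extCentralizer : Subring M := Subring.centralizer (f.range : Set M)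

variable {f}

theorem extCentralizer_comm (c : extCentralizer f) (n : N) : f n * (c : M) = c * f n :=
  Subring.mem_centralizer_iff.mp c.2 _ ⟨n, rfl⟩

/-- The element `m ↦ α m` of `End _N M_N`. -/
def bimodEnd.mk (α : M →+ M) (hl : ∀ n m, α (f n * m) = f n * α m)
    (hr : ∀ n m, α (m * f n) = α m * f n) : bimodEnd f :=
  ⟨α, hl, hr⟩

variable (f)

/-- Left multiplications `λ : L → A`, `λ(c) m = c m`. -/
def leftMulHom : extCentralizer f →+* bimodEnd f where
  toFun := fun c => bimodEnd.mk (AddMonoidHom.mulLeft (c : M))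
    (fun n m => by
      change (c : M) * (f n * m) = f n * (c * m)
      rw [← mul_assoc, ← extCentralizer_comm, mul_assoc])
    (fun n m => (mul_assoc (c : M) m (f n)).symm)
  map_one' := by ext m; exact one_mul m
  map_mul' := fun c d => by ext m; exact mul_assoc (c : M) d m
  map_zero' := by ext m; exact zero_mul m
  map_add' := fun c d => by ext m; exact add_mul (c : M) d m

/-- Right multiplications `ρ : L^op → A`, `ρ(c) m = m c`. -/
def rightMulHom : (extCentralizer f)ᵐᵒᵖ →+* bimodEnd f where
  toFun := fun c => bimodEnd.mk (AddMonoidHom.mulRight (unop c).1)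
    (fun n m => mul_assoc (f n) m (unop c).1)
    (fun n m => by
      change m * f n * (unop c).1 = m * (unop c).1 * f n
      rw [mul_assoc, extCentralizer_comm, mul_assoc])
  map_one' := by ext m; exact mul_one m
  map_mul' := fun c d => by ext m; exact (mul_assoc m (unop d).1 (unop c).1).symm
  map_zero' := by ext m; exact mul_zero m
  map_add' := fun c d => by ext m; exact mul_add m (unop c).1 (unop d).1

/-- `s_L = λ : L → A` and `t_L = ρ : L^op → A`. -/
def leftST : SourceTarget (bimodEnd f) (extCentralizer f) where
  s := leftMulHom f
  t := rightMulHom f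
  comm := fun c d => by ext m; exact (mul_assoc (c : M) m (unop d).1).symm

/-- `π_L : A → L`, `π_L(α) = α(1)`. -/
def leftCounit : bimodEnd f →+ extCentralizer f where
  toFun := fun α => ⟨α.1 1, Subring.mem_centralizer_iff.mpr (by
    rintro _ ⟨n, rfl⟩
    rw [← α.2.1, ← α.2.2, mul_one, one_mul])⟩
  map_zero' := rfl
  map_add' := fun _ _ => rfl

/-- `A_L ⊗ _L A → M`, `α ⊗ β ↦ α(m) β(m')`. -/
def leftEval (m m' : M) : BTensor (leftST f).bimodL (leftST f).bimodL →+ M :=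
  BTensor.lift
    (AddMonoidHom.mk' (fun α => AddMonoidHom.mk' (fun β => α.1 m * β.1 m')
        (fun _ _ => mul_add _ _ _))
      (fun α α' => by ext β; exact add_mul (α.1 m) (α'.1 m) (β.1 m')))
    (by
      intro α c β
      refine Eq.trans ?_ rfl
      exact mul_assoc (α.1 m) (c : M) (β.1 m'))

/-- The data `(A, L, s_L, t_L, γ_L, π_L)` for a given `γ_L`. -/
def leftData (γ : bimodEnd f →+ BTensor (leftST f).bimodL (leftST f).bimodL) :
    LeftBgdData (bimodEnd f) (extCentralizer f) :=
  { leftST f with comul := γ, counit := leftCounit f }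

/-- `X ↦ x · X`, `a ⊗ b ↦ x a ⊗ b`, on `M ⊗_N M`. -/
def extTensorLeft (x : M) : ExtTensor f →+ ExtTensor f :=
  BTensor.map (AddMonoidHom.mulLeft x) (AddMonoidHom.id M)
    (by intro n m; refine Eq.trans ?_ rfl; exact (mul_assoc x m (f n)).symm)
    (by intros; refine Eq.trans ?_ rfl; rfl)

/-- `X ↦ X · x`, `a ⊗ b ↦ a ⊗ b x`, on `M ⊗_N M`. -/
def extTensorRight (x : M) : ExtTensor f →+ ExtTensor f :=
  BTensor.map (AddMonoidHom.id M) (AddMonoidHom.mulRight x)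
    (by intros; refine Eq.trans ?_ rfl; rfl)
    (by intro n m; refine Eq.trans ?_ rfl; exact mul_assoc (f n) m x)

/-- `B = (M ⊗_N M)^N`: the tensor `X` satisfies `n · X = X · n` for all `n ∈ N`. -/
def IsNCentral (X : ExtTensor f) : Prop :=
  ∀ n, extTensorLeft f (f n) X = extTensorRight f (f n) X

/-- Existence of a left D2 quasibasis: `b_i ∈ B`, `β_i ∈ A` with
`Σ_i b_i¹ ⊗ b_i² β_i(m) = m ⊗ 1` for all `m`. -/
def HasLeftD2Quasibasis : Prop :=
  ∃ (k : ℕ) (b : Fin k → ExtTensor f) (β : Fin k → bimodEnd f),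
    (∀ i, IsNCentral f (b i)) ∧
    ∀ m : M, ∑ i, extTensorRight f ((β i).1 m) (b i) = BTensor.tmul _ _ m 1

/-- Existence of a right D2 quasibasis: `c_i ∈ B`, `γ_i ∈ A` with
`Σ_i γ_i(m) c_i¹ ⊗ c_i² = 1 ⊗ m` for all `m`. -/
def HasRightD2Quasibasis : Prop :=
  ∃ (k : ℕ) (c : Fin k → ExtTensor f) (γ : Fin k → bimodEnd f),
    (∀ i, IsNCentral f (c i)) ∧
    ∀ m : M, ∑ i, extTensorLeft f ((γ i).1 m) (c i) = BTensor.tmul _ _ 1 m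

/-- A Frobenius homomorphism `ψ : M → N`, an `N`-`N`-bimodule map, with a quasibasis
`Σ_i u_i ⊗ v_i`: `Σ_i ψ(m u_i) v_i = m = Σ_i u_i ψ(v_i m)`. -/
structure FrobeniusSystem where
  ψ : M →+ N
  ψ_left : ∀ n m, ψ (f n * m) = n * ψ m
  ψ_right : ∀ n m, ψ (m * f n) = ψ m * n
  k : ℕ
  u : Fin k → M
  v : Fin k → M
  quasi_left : ∀ m, ∑ i, f (ψ (m * u i)) * v i = m
  quasi_right : ∀ m, ∑ i, u i * f (ψ (v i * m)) = m

namespace FrobeniusSystem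

variable {f} (F : FrobeniusSystem f)

/-- `x ∈ M` is determined by the values `ψ(m x)`. -/
theorem ext_right {x y : M} (h : ∀ m, F.ψ (m * x) = F.ψ (m * y)) : x = y := by
  rw [← F.quasi_right x, ← F.quasi_right y]
  simp [h]

/-- `x ∈ M` is determined by the values `ψ(x m)`. -/
theorem ext_left {x y : M} (h : ∀ m, F.ψ (x * m) = F.ψ (y * m)) : x = y := by
  rw [← F.quasi_left x, ← F.quasi_left y]
  simp [h]

/-- `S_A(α)(m) = Σ_i u_i ψ(α(v_i) m)` -/
def antipodeFun (α : bimodEnd f) : M →+ M :=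
  ∑ i, (AddMonoidHom.mulLeft (F.u i)).comp ((f : N →+ M).comp
    (F.ψ.comp (AddMonoidHom.mulLeft (α.1 (F.v i)))))

theorem antipodeFun_apply (α : bimodEnd f) (m : M) :
    F.antipodeFun α m = ∑ i, F.u i * f (F.ψ (α.1 (F.v i) * m)) := by
  simp [antipodeFun, AddMonoidHom.finsetSum_apply]

/-- `S_A(α)` is the transpose of `α` with respect to the form `ψ(m m')`. -/
theorem ψ_antipodeFun (α : bimodEnd f) (m m' : M) :
    F.ψ (m * F.antipodeFun α m') = F.ψ (α.1 m * m') := by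
  rw [antipodeFun_apply, Finset.mul_sum, map_sum]
  conv_rhs => rw [← F.quasi_left m, map_sum, Finset.sum_mul, map_sum]
  refine Finset.sum_congr rfl fun i _ => ?_
  rw [← mul_assoc, F.ψ_right, α.2.1, mul_assoc, F.ψ_left]

/-- The antipode `S_A : A → A`, `S_A(α)(m) = Σ_i u_i ψ(α(v_i) m)`. -/
def antipode (α : bimodEnd f) : bimodEnd f :=
  bimodEnd.mk (F.antipodeFun α)
    (fun n m => F.ext_right fun x => by
      rw [ψ_antipodeFun, ← mul_assoc, ← mul_assoc, ψ_antipodeFun, α.2.2])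
    (fun n m => F.ext_right fun x => by
      rw [ψ_antipodeFun, ← mul_assoc, ← mul_assoc, F.ψ_right, F.ψ_right, ψ_antipodeFun])

/-- `ν(c) = Σ_i ψ(u_i c) v_i` -/
def nakayamaFun (c : extCentralizer f) : M := ∑ i, f (F.ψ (F.u i * c)) * F.v i

/-- `ν⁻¹(c) = Σ_i u_i ψ(c v_i)` -/
def nakayamaInvFun (c : extCentralizer f) : M := ∑ i, F.u i * f (F.ψ (c * F.v i))

theorem ψ_nakayamaFun (c : extCentralizer f) (m : M) :
    F.ψ (F.nakayamaFun c * m) = F.ψ (m * c) := by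
  conv_rhs => rw [← F.quasi_right m, Finset.sum_mul, map_sum]
  rw [nakayamaFun, Finset.sum_mul, map_sum]
  refine Finset.sum_congr rfl fun i _ => ?_
  rw [mul_assoc, F.ψ_left, mul_assoc, extCentralizer_comm, ← mul_assoc, F.ψ_right]

theorem ψ_nakayamaInvFun (c : extCentralizer f) (m : M) :
    F.ψ (m * F.nakayamaInvFun c) = F.ψ (c * m) := by
  conv_rhs => rw [← F.quasi_left m, Finset.mul_sum, map_sum]
  rw [nakayamaInvFun, Finset.mul_sum, map_sum]
  refine Finset.sum_congr rfl fun i _ => ?_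
  rw [← mul_assoc, F.ψ_right, ← mul_assoc, ← extCentralizer_comm, mul_assoc, F.ψ_left]

theorem nakayamaFun_mem (c : extCentralizer f) : F.nakayamaFun c ∈ extCentralizer f := by
  rw [Subring.mem_centralizer_iff]
  rintro _ ⟨n, rfl⟩
  refine F.ext_left fun m => ?_
  rw [mul_assoc, F.ψ_left, ψ_nakayamaFun, mul_assoc, ψ_nakayamaFun, mul_assoc, F.ψ_left]

theorem nakayamaInvFun_mem (c : extCentralizer f) : F.nakayamaInvFun c ∈ extCentralizer f := by
  rw [Subring.mem_centralizer_iff]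
  rintro _ ⟨n, rfl⟩
  refine F.ext_right fun m => ?_
  rw [← mul_assoc, ψ_nakayamaInvFun, ← mul_assoc, ← mul_assoc, F.ψ_right, F.ψ_right,
    ψ_nakayamaInvFun]

/-- The Nakayama automorphism `ν` of `L = C_M(N)`, `ν(c) = Σ_i ψ(u_i c) v_i`. -/
def nakayama : extCentralizer f ≃+* extCentralizer f where
  toFun := fun c => ⟨F.nakayamaFun c, F.nakayamaFun_mem c⟩
  invFun := fun c => ⟨F.nakayamaInvFun c, F.nakayamaInvFun_mem c⟩
  left_inv := fun c => Subtype.ext <| F.ext_right fun m => by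
    rw [ψ_nakayamaInvFun]
    exact F.ψ_nakayamaFun c m
  right_inv := fun c => Subtype.ext <| F.ext_left fun m => by
    rw [ψ_nakayamaFun]
    exact F.ψ_nakayamaInvFun c m
  map_mul' := fun c d => Subtype.ext <| F.ext_left fun m => by
    change F.ψ (F.nakayamaFun (c * d) * m) = F.ψ (F.nakayamaFun c * F.nakayamaFun d * m)
    rw [ψ_nakayamaFun, mul_assoc, ψ_nakayamaFun, mul_assoc, ψ_nakayamaFun]
    simp [mul_assoc]
  map_add' := fun c d => Subtype.ext <| F.ext_left fun m => by
    change F.ψ (F.nakayamaFun (c + d) * m) = F.ψ ((F.nakayamaFun c + F.nakayamaFun d) * m)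
    rw [ψ_nakayamaFun, add_mul, map_add, ψ_nakayamaFun, ψ_nakayamaFun, ← map_add, ← mul_add]
    rfl

/-- `θ = ν⁻¹ : L → R^op`, where `R = L^op`. -/
def theta : extCentralizer f →+* (extCentralizer f)ᵐᵒᵖᵐᵒᵖ :=
  (RingEquiv.opOp (extCentralizer f)).toRingHom.comp F.nakayama.symm.toRingHom

/-- `π_R(α) = Σ_i u_i ψ(α(v_i))`, an element of `C_M(N)` -/
def rightCounitFun (α : bimodEnd f) : M := ∑ i, F.u i * f (F.ψ (α.1 (F.v i)))

theorem ψ_rightCounitFun (α : bimodEnd f) (m : M) :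
    F.ψ (m * F.rightCounitFun α) = F.ψ (α.1 m) := by
  have h := F.ψ_antipodeFun α m 1
  rw [antipodeFun_apply] at h
  simpa [rightCounitFun] using h

theorem rightCounitFun_mem (α : bimodEnd f) : F.rightCounitFun α ∈ extCentralizer f := by
  rw [Subring.mem_centralizer_iff]
  rintro _ ⟨n, rfl⟩
  refine F.ext_right fun m => ?_
  rw [← mul_assoc, ψ_rightCounitFun, ← mul_assoc, F.ψ_right, ψ_rightCounitFun, α.2.2, F.ψ_right]

/-- `π_R : A → R = L^op`, `π_R(α) = Σ_i u_i ψ(α(v_i))`. -/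
def rightCounit : bimodEnd f →+ (extCentralizer f)ᵐᵒᵖ where
  toFun := fun α => op ⟨F.rightCounitFun α, F.rightCounitFun_mem α⟩
  map_zero' := unop_injective <| Subtype.ext <| F.ext_right fun m => by
    change F.ψ (m * F.rightCounitFun 0) = F.ψ (m * 0)
    rw [ψ_rightCounitFun, mul_zero]
    rfl
  map_add' := fun α β => unop_injective <| Subtype.ext <| F.ext_right fun m => by
    change F.ψ (m * F.rightCounitFun (α + β)) =
      F.ψ (m * (F.rightCounitFun α + F.rightCounitFun β))
    rw [mul_add, map_add]
    simp only [ψ_rightCounitFun, ← map_add]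
    rfl

/-- `s_R = ρ : R → A` and `t_R = λ ∘ ν : R^op → A`, where `R = L^op`. -/
def rightST : SourceTarget (bimodEnd f) (extCentralizer f)ᵐᵒᵖ where
  s := rightMulHom f
  t := (leftMulHom f).comp
    (F.nakayama.toRingHom.comp (RingEquiv.opOp (extCentralizer f)).symm.toRingHom)
  comm := fun c d => by
    ext m
    exact mul_assoc (F.nakayama (unop (unop d)) : M) m (unop c).1

theorem sum_tmul_mul (c : extCentralizer f) :
    ∑ i, BTensor.tmul (extBimod f) (extBimod f) (F.u i * c) (F.v i) =
      ∑ i, BTensor.tmul (extBimod f) (extBimod f) (F.u i) (F.nakayama c * F.v i) := by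
  have h1 : ∀ i, BTensor.tmul (extBimod f) (extBimod f) (F.u i * c) (F.v i) =
      ∑ j, BTensor.tmul (extBimod f) (extBimod f) (F.u j)
        (f (F.ψ (F.v j * (F.u i * c))) * F.v i) := by
    intro i
    conv_lhs => rw [← F.quasi_right (F.u i * c)]
    change (BTensor.tmulHom _ _).flip (F.v i) _ = _
    rw [map_sum]
    exact Finset.sum_congr rfl fun j _ => BTensor.balanced (F.u j) _ (F.v i)
  simp only [h1]
  rw [Finset.sum_comm]
  refine Finset.sum_congr rfl fun j _ => ?_
  conv_rhs => rw [← F.quasi_left (F.nakayama c * F.v j)]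
  change _ = BTensor.tmulHom _ _ (F.u j) _
  rw [map_sum]
  refine Finset.sum_congr rfl fun i _ => ?_
  have h2 : F.ψ (F.v j * (F.u i * c)) = F.ψ (F.nakayama c * F.v j * F.u i) := by
    rw [← mul_assoc, mul_assoc _ (F.v j)]
    exact (F.ψ_nakayamaFun c _).symm
  rw [h2]
  rfl

/-- `α ⊗ β` as an endomorphism of `M ⊗_N M`. -/
def endTensor (α β : bimodEnd f) : ExtTensor f →+ ExtTensor f :=
  BTensor.map α.1 β.1 (by intro n m; refine Eq.trans ?_ rfl; exact α.2.2 n m)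
    (by intro n m; refine Eq.trans ?_ rfl; exact β.2.1 n m)

/-- `A^R ⊗ ^R A → M ⊗_N M`, `α ⊗ β ↦ Σ_i α(m u_i) ⊗ β(v_i)`. -/
def rightEval (m : M) : BTensor F.rightST.bimodR F.rightST.bimodR →+ ExtTensor f :=
  BTensor.lift
    (AddMonoidHom.mk' (fun α => AddMonoidHom.mk'
        (fun β => ∑ i, BTensor.tmul (extBimod f) (extBimod f) (α.1 (m * F.u i)) (β.1 (F.v i)))
        (fun β β' => by
          rw [← Finset.sum_add_distrib]
          exact Finset.sum_congr rfl fun i _ => BTensor.tmul_add _ _ _))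
      (fun α α' => by
        ext β
        have h : ∑ i, BTensor.tmul (extBimod f) (extBimod f)
              (α.1 (m * F.u i) + α'.1 (m * F.u i)) (β.1 (F.v i)) =
            ∑ i, BTensor.tmul (extBimod f) (extBimod f) (α.1 (m * F.u i)) (β.1 (F.v i)) +
            ∑ i, BTensor.tmul (extBimod f) (extBimod f) (α'.1 (m * F.u i)) (β.1 (F.v i)) := by
          simp only [BTensor.add_tmul, Finset.sum_add_distrib]
        exact h))
    (by
      intro α r β
      refine Eq.trans ?_ rfl
      have h := congrArg (fun X => endTensor α β (extTensorLeft f m X)) (F.sum_tmul_mul (unop r))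
      simp only [map_sum] at h
      have h' : ∀ i, BTensor.tmul (extBimod f) (extBimod f)
          (α.1 (m * F.u i * (unop r).1)) (β.1 (F.v i)) =
          BTensor.tmul (extBimod f) (extBimod f)
            (α.1 (m * (F.u i * (unop r).1))) (β.1 (F.v i)) := fun i => by rw [mul_assoc]
      exact (Finset.sum_congr rfl fun i _ => h' i).trans h)

/-- The data `(A, R, s_R, t_R, γ_R, π_R)` for a given `γ_R`. -/
def rightData (γ : bimodEnd f →+ BTensor F.rightST.bimodR F.rightST.bimodR) :
    RightBgdData (bimodEnd f) (extCentralizer f)ᵐᵒᵖ :=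
  { F.rightST with comul := γ, counit := F.rightCounit }

end FrobeniusSystem

end Extension

/-! Write `A = End _N M_N`, `L = C_M(N)`. The Frobenius structure turns either depth two condition
into one symmetric statement: there are `a_i, b_i ∈ A` with `∑ a_i(m) b_i(m') = ψ(m m')`
(`FrobeniusSystem.exists_form_decomposition`). It has two consequences.

* Together with the quasibasis it presents `A` as a finitely generated projective right `L`-module
  with generators `a_i` and coordinates `x ↦ ∑ b_i(u_n) x(v_n)`. Hence tensors over `L` are
  determined by their evaluations in `M`: `x ⊗ y ↦ x(m) y(m')` on `A ⊗_L A`, and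
  likewise on threefold tensor products (`FrobeniusSystem.eq_zero_of_evalTensor`).
* The tensor `∑_i (∑_n α(- u_n) a_i(v_n)) ⊗ b_i` evaluates to `α(m m')`
  (`FrobeniusSystem.exists_leftEval_eq`), so `γ_L` exists.

All axioms of the left bialgebroid then become identities between evaluations, that is, the
associativity and unit laws of `M` (`FrobeniusSystem.isLeftBialgebroid`).

Nothing needs to be verified again for the right bialgebroid. An anti-isomorphism of total and base
rings, combined with the flip of tensor factors, exchanges left and right bialgebroids
(`IsLeftBialgebroid.antiTransport`, `IsRightBialgebroid.antiTransport`). Applied to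
`S_A⁻¹ : A_L → A_R` this makes `A_R` a right bialgebroid with
`γ_R = (S_A⁻¹ ⊗ S_A⁻¹) ∘ flip ∘ γ_L ∘ S_A`, and applied to the identity it shows that
`(-)^op_cop` exchanges left and right bialgebroids. Since `S_A` is a transposition for the
nondegenerate form `ψ(m m')`, pairing `M ⊗_N M` with the form identifies the defining
property of `γ_R(α)` with that of `γ_L(S_A(α))` (`FrobeniusSystem.rightEval_flipInv_iff`),
and shows that also
`γ_R(S_A(α)) = (S_A ⊗ S_A) (flip (γ_L(α)))` (`FrobeniusSystem.rightEval_flipAntipode`). These two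
relations are the compatibility of `S_A` with the comultiplications in the two isomorphisms.
-/

/-! ### Transport of comonoids along an anti-isomorphism -/

section AntiTransport

variable {L X Y L' X' Y' : Type*} [Ring L] [AddCommGroup X] [AddCommGroup Y]
  [Ring L'] [AddCommGroup X'] [AddCommGroup Y']

/-- The map `X ⊗_L Y → Y' ⊗_L' X'`, `x ⊗ y ↦ h y ⊗ g x`, for additive maps `g : X → X'` and
`h : Y → Y'` that exchange left and right actions along the anti-isomorphism `φ` from `L`
to `L'`. -/
def BTensor.antiMap {P : BimodStr L X} {Q : BimodStr L Y} {P' : BimodStr L' X'}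
    {Q' : BimodStr L' Y'} (φ : L ≃+* L'ᵐᵒᵖ) (g : X →+ X') (h : Y →+ Y')
    (hg : ∀ a x, g (P.r (op a) x) = P'.l (unop (φ a)) (g x))
    (hh : ∀ a y, h (Q.l a y) = Q'.r (φ a) (h y)) : BTensor P Q →+ BTensor Q' P' :=
  BTensor.lift (((BTensor.tmulHom Q' P').flip.comp g).compl₂ h)
    (fun x a y => by
      have := BTensor.balanced (P := Q') (Q := P') (h y) (unop (φ a)) (g x)
      simpa [hg, hh] using this.symm)

variable {P : BimodStr L X} {P' : BimodStr L' X'} (φ : L ≃+* L'ᵐᵒᵖ) (Φ : X ≃+ X')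
  (hl : ∀ a x, Φ (P.l a x) = P'.r (φ a) (Φ x))
  (hr : ∀ a x, Φ (P.r (op a) x) = P'.l (unop (φ a)) (Φ x))

/-- The map `x ⊗ y ↦ Φ y ⊗ Φ x` induced by an anti-isomorphism `Φ` of bimodules. -/
def antiFlip : BTensor P P →+ BTensor P' P' :=
  BTensor.antiMap φ (Φ : X →+ X') (Φ : X →+ X') hr hl

theorem antiFlip_l (a : L) (T : BTensor P P) :
    antiFlip φ Φ hl hr ((P.tensor P).l a T) = (P'.tensor P').r (φ a) (antiFlip φ Φ hl hr T) := by
  induction T using BTensor.induction with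
  | h0 => simp only [map_zero]
  | ht x y => exact congrArg (BTensor.tmul P' P' (Φ y)) (hl a x)
  | ha S T hS hT => simp only [map_add, hS, hT]

theorem antiFlip_r (a : L) (T : BTensor P P) :
    antiFlip φ Φ hl hr ((P.tensor P).r (op a) T) =
      (P'.tensor P').l (unop (φ a)) (antiFlip φ Φ hl hr T) := by
  induction T using BTensor.induction with
  | h0 => simp only [map_zero]
  | ht x y => exact congrArg (fun z => BTensor.tmul P' P' z (Φ x)) (hr a y)
  | ha S T hS hT => simp only [map_add, hS, hT]

/-- An anti-isomorphism carries comonoids to comonoids. Coassociativity is mapped to itself with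
the two sides exchanged, by the flips of the threefold tensor products. -/
theorem IsComonoid.antiTransport {γ : X →+ BTensor P P} {π : X →+ L}
    (h : IsComonoid P γ π) {γ' : X' →+ BTensor P' P'} {π' : X' →+ L'}
    (hγ : ∀ x, γ' (Φ x) = antiFlip φ Φ hl hr (γ x)) (hπ : ∀ x, π' (Φ x) = unop (φ (π x))) :
    IsComonoid P' γ' π' := by
  have hφ : ∀ a : L', ∃ b, unop (φ b) = a := fun a => ⟨φ.symm (op a), by simp⟩
  have hφr : ∀ a x, P'.r (op (unop (φ a))) (Φ x) = Φ (P.l a x) := fun a x => (hl a x).symm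
  have cl : ∀ a x, γ' (P'.l a x) = (P'.tensor P').l a (γ' x) := by
    intro a x
    obtain ⟨a, rfl⟩ := hφ a
    obtain ⟨x, rfl⟩ := Φ.surjective x
    rw [← hr, hγ, hγ, h.comul_right, antiFlip_r]
  have cr : ∀ a x, γ' (P'.r (op a) x) = (P'.tensor P').r (op a) (γ' x) := by
    intro a x
    obtain ⟨a, rfl⟩ := hφ a
    obtain ⟨x, rfl⟩ := Φ.surjective x
    rw [hφr, hγ, hγ, h.comul_left, antiFlip_l, op_unop]
  have pl : ∀ a x, π' (P'.l a x) = a * π' x := by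
    intro a x
    obtain ⟨a, rfl⟩ := hφ a
    obtain ⟨x, rfl⟩ := Φ.surjective x
    rw [← hr, hπ, hπ, h.counit_right, map_mul, unop_mul]
  have pr : ∀ a x, π' (P'.r (op a) x) = π' x * a := by
    intro a x
    obtain ⟨a, rfl⟩ := hφ a
    obtain ⟨x, rfl⟩ := Φ.surjective x
    rw [hφr, hπ, hπ, h.counit_left, map_mul, unop_mul]
  refine ⟨cl, cr, pl, pr, ?_, ?_, ?_⟩
  · intro x
    obtain ⟨x, rfl⟩ := Φ.surjective x
    rw [hγ]
    -- `x ⊗ (y ⊗ z) ↦ (z ⊗ y) ⊗ x` and `(x ⊗ y) ⊗ z ↦ z ⊗ (y ⊗ x)`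
    let σ : BTensor P (P.tensor P) →+ BTensor (P'.tensor P') P' :=
      BTensor.antiMap φ (Φ : X →+ X') (antiFlip φ Φ hl hr) hr (antiFlip_l φ Φ hl hr)
    let σ' : BTensor (P.tensor P) P →+ BTensor P' (P'.tensor P') :=
      BTensor.antiMap φ (antiFlip φ Φ hl hr) (Φ : X →+ X') (antiFlip_r φ Φ hl hr) hl
    have h1 : ∀ T : BTensor P P,
        BTensor.map (P' := P'.tensor P') (Q' := P') γ' (AddMonoidHom.id X') cr
          (by intros; refine Eq.trans ?_ rfl; rfl) (antiFlip φ Φ hl hr T) =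
        σ (BTensor.map (P' := P) (Q' := P.tensor P) (AddMonoidHom.id X) γ
          (by intros; refine Eq.trans ?_ rfl; rfl) h.comul_left T) := by
      intro T
      induction T using BTensor.induction with
      | h0 => simp only [map_zero]
      | ht x y => exact congrArg (fun z => BTensor.tmul (P'.tensor P') P' z (Φ x)) (hγ y)
      | ha S T hS hT => simp only [map_add, hS, hT]
    have h2 : ∀ T : BTensor P P,
        BTensor.map (P' := P') (Q' := P'.tensor P') (AddMonoidHom.id X') γ'
          (by intros; refine Eq.trans ?_ rfl; rfl) cl (antiFlip φ Φ hl hr T) =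
        σ' (BTensor.map (P' := P.tensor P) (Q' := P) γ (AddMonoidHom.id X)
          h.comul_right (by intros; refine Eq.trans ?_ rfl; rfl) T) := by
      intro T
      induction T using BTensor.induction with
      | h0 => simp only [map_zero]
      | ht x y => exact congrArg (fun z => BTensor.tmul P' (P'.tensor P') (Φ y) z) (hγ x)
      | ha S T hS hT => simp only [map_add, hS, hT]
    have h3 : ∀ W : BTensor (P.tensor P) P,
        BTensor.assoc P' P' P' (σ (BTensor.assoc P P P W)) = σ' W := by
      intro W
      induction W using BTensor.induction with
      | h0 => simp only [map_zero]
      | ht T z =>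
        induction T using BTensor.induction with
        | h0 =>
          have : BTensor.tmul (P.tensor P) P 0 z = 0 := by
            rw [← BTensor.tmulHom_apply, map_zero]; rfl
          simp only [this, map_zero]
        | ht x y => rfl
        | ha S T hS hT => simp only [BTensor.add_tmul, map_add, hS, hT]
      | ha S T hS hT => simp only [map_add, hS, hT]
    rw [h1, h2, ← h.coassoc, h3]
  · intro x
    obtain ⟨x, rfl⟩ := Φ.surjective x
    rw [hγ]
    conv_rhs => rw [← h.comul_counit x]
    generalize γ x = T
    induction T using BTensor.induction with
    | h0 => simp only [map_zero]
    | ht x y =>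
      change P'.l (π' (Φ y)) (Φ x) = Φ (P.r (op (π y)) x)
      rw [hπ, hr]
    | ha S T hS hT => simp only [map_add, hS, hT]
  · intro x
    obtain ⟨x, rfl⟩ := Φ.surjective x
    rw [hγ]
    conv_rhs => rw [← h.counit_comul x]
    generalize γ x = T
    induction T using BTensor.induction with
    | h0 => simp only [map_zero]
    | ht x y =>
      change P'.r (op (π' (Φ x))) (Φ y) = Φ (P.l (π x) y)
      rw [hπ, hl, op_unop]
    | ha S T hS hT => simp only [map_add, hS, hT]

end AntiTransport

/-! ### Transport of bialgebroids along an anti-isomorphism -/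

section BialgebroidAntiTransport

variable {A L A' L' : Type*} [Ring A] [Ring L] [Ring A'] [Ring L']
  (φ : L ≃+* L'ᵐᵒᵖ) (Ψ : A ≃+* A'ᵐᵒᵖ)

/-- The additive isomorphism underlying an anti-isomorphism of rings. -/
def antiAddEquiv : A ≃+ A' := Ψ.toAddEquiv.trans (opAddEquiv : A' ≃+ A'ᵐᵒᵖ).symm

theorem antiAddEquiv_mul (x y : A) :
    antiAddEquiv Ψ (x * y) = antiAddEquiv Ψ y * antiAddEquiv Ψ x := by
  simp [antiAddEquiv]

theorem antiAddEquiv_one : antiAddEquiv Ψ 1 = 1 := by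
  simp [antiAddEquiv]

/-- `x ⊗ y ↦ Φ y ⊗ Φ x`, from `A_L ⊗ _L A` to `A'^R ⊗ ^R A'`, for an anti-isomorphism `Φ` of the
total rings over an anti-isomorphism `φ` of the base rings. -/
def antiFlipLR (D : SourceTarget A L) (D' : SourceTarget A' L')
    (hs : ∀ l, D'.s (unop (φ l)) = antiAddEquiv Ψ (D.s l))
    (ht : ∀ l, D'.t (φ l) = antiAddEquiv Ψ (D.t (op l))) :
    BTensor D.bimodL D.bimodL →+ BTensor D'.bimodR D'.bimodR :=
  antiFlip φ (antiAddEquiv Ψ)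
    (fun a x => by simp [antiAddEquiv_mul, hs])
    (fun a x => by simp [antiAddEquiv_mul, ht])

/-- `x ⊗ y ↦ Φ y ⊗ Φ x`, from `A^R ⊗ ^R A` to `A'_L' ⊗ _L' A'`, for an anti-isomorphism `Φ` of
the total rings over an anti-isomorphism `φ` of the base rings. -/
def antiFlipRL (D : SourceTarget A L) (D' : SourceTarget A' L')
    (hs : ∀ l, D'.s (unop (φ l)) = antiAddEquiv Ψ (D.s l))
    (ht : ∀ l, D'.t (φ l) = antiAddEquiv Ψ (D.t (op l))) :
    BTensor D.bimodR D.bimodR →+ BTensor D'.bimodL D'.bimodL :=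
  antiFlip φ (antiAddEquiv Ψ)
    (fun a x => by simp [antiAddEquiv_mul, ht])
    (fun a x => by simp [antiAddEquiv_mul, hs])

/-- An anti-isomorphism carries left bialgebroids to right bialgebroids, when the
comultiplications correspond up to the flip. -/
theorem IsLeftBialgebroid.antiTransport {D : LeftBgdData A L} (h : IsLeftBialgebroid D)
    {D' : RightBgdData A' L'}
    (hs : ∀ l, D'.s (unop (φ l)) = antiAddEquiv Ψ (D.s l))
    (ht : ∀ l, D'.t (φ l) = antiAddEquiv Ψ (D.t (op l)))
    (hγ : ∀ x, D'.comul (antiAddEquiv Ψ x) =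
      antiFlipLR φ Ψ D.toSourceTarget D'.toSourceTarget hs ht (D.comul x))
    (hπ : ∀ x, D'.counit (antiAddEquiv Ψ x) = unop (φ (D.counit x))) :
    IsRightBialgebroid D' := by
  have hφ : ∀ a : L', ∃ b, unop (φ b) = a := fun a => ⟨φ.symm (op a), by simp⟩
  set Φ := antiAddEquiv Ψ with hΦ
  have hmul : ∀ x y T, antiFlipLR φ Ψ D.toSourceTarget D'.toSourceTarget hs ht
      (D.rightMul x y T) = D'.leftMul (Φ y) (Φ x)
        (antiFlipLR φ Ψ D.toSourceTarget D'.toSourceTarget hs ht T) := by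
    intro x y T
    induction T using BTensor.induction with
    | h0 => simp only [map_zero]
    | ht a b =>
      change BTensor.tmul _ _ (Φ (b * y)) (Φ (a * x)) = BTensor.tmul _ _ (Φ y * Φ b) (Φ x * Φ a)
      rw [hΦ, antiAddEquiv_mul, antiAddEquiv_mul]
    | ha S T hS hT => simp only [map_add, hS, hT]
  have tak : ∀ a, ∀ r : L',
      D'.leftMul (D'.s r) 1 (D'.comul a) = D'.leftMul 1 (D'.t (op r)) (D'.comul a) := by
    intro a r
    obtain ⟨l, rfl⟩ := hφ r
    obtain ⟨a, rfl⟩ := Φ.surjective a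
    have h1 : Φ 1 = 1 := antiAddEquiv_one Ψ
    have := congrArg (antiFlipLR φ Ψ D.toSourceTarget D'.toSourceTarget hs ht) (h.takeuchi a l)
    rw [hmul, hmul, h1] at this
    rw [hγ, hs, op_unop, ht, this]
  refine ⟨?_, tak, ?_, ?_, ?_, ?_, ?_⟩
  · exact h.comonoid.antiTransport φ Φ _ _ hγ hπ
  · have h1 : Φ 1 = 1 := antiAddEquiv_one Ψ
    rw [← h1, hγ, h.comul_one]
    rfl
  · intro a b
    have key : ∀ T hT T' hT' W,
        T' = antiFlipLR φ Ψ D.toSourceTarget D'.toSourceTarget hs ht T →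
        antiFlipLR φ Ψ D.toSourceTarget D'.toSourceTarget hs ht (D.tensorMulL T hT W) =
          D'.tensorMulR T' hT' (antiFlipLR φ Ψ D.toSourceTarget D'.toSourceTarget hs ht W) := by
      rintro T hT T' hT' W rfl
      induction W using BTensor.induction with
      | h0 => simp only [map_zero]
      | ht x y => exact hmul x y T
      | ha S T hS hT => simp only [map_add, hS, hT]
    obtain ⟨a, rfl⟩ := Φ.surjective a
    obtain ⟨b, rfl⟩ := Φ.surjective b
    rw [hΦ, ← antiAddEquiv_mul, hγ, h.comul_mul, key _ _ _ (tak _) _ (hγ b), ← hγ a]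
  · have h1 : Φ 1 = 1 := antiAddEquiv_one Ψ
    rw [← h1, hπ, h.counit_one, map_one, unop_one]
  · intro a b
    obtain ⟨a, rfl⟩ := Φ.surjective a
    obtain ⟨b, rfl⟩ := Φ.surjective b
    rw [hπ a, hs, hΦ, ← antiAddEquiv_mul, ← antiAddEquiv_mul, hπ, hπ, h.counit_mul_s]
  · intro a b
    obtain ⟨a, rfl⟩ := Φ.surjective a
    obtain ⟨b, rfl⟩ := Φ.surjective b
    rw [hπ a, op_unop, ht, hΦ, ← antiAddEquiv_mul, ← antiAddEquiv_mul, hπ, hπ, h.counit_mul_t]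

/-- An anti-isomorphism carries right bialgebroids to left bialgebroids, when the
comultiplications correspond up to the flip. -/
theorem IsRightBialgebroid.antiTransport {D : RightBgdData A L} (h : IsRightBialgebroid D)
    {D' : LeftBgdData A' L'}
    (hs : ∀ l, D'.s (unop (φ l)) = antiAddEquiv Ψ (D.s l))
    (ht : ∀ l, D'.t (φ l) = antiAddEquiv Ψ (D.t (op l)))
    (hγ : ∀ x, D'.comul (antiAddEquiv Ψ x) =
      antiFlipRL φ Ψ D.toSourceTarget D'.toSourceTarget hs ht (D.comul x))
    (hπ : ∀ x, D'.counit (antiAddEquiv Ψ x) = unop (φ (D.counit x))) :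
    IsLeftBialgebroid D' := by
  have hφ : ∀ a : L', ∃ b, unop (φ b) = a := fun a => ⟨φ.symm (op a), by simp⟩
  set Φ := antiAddEquiv Ψ with hΦ
  have hmul : ∀ x y T, antiFlipRL φ Ψ D.toSourceTarget D'.toSourceTarget hs ht
      (D.leftMul x y T) = D'.rightMul (Φ y) (Φ x)
        (antiFlipRL φ Ψ D.toSourceTarget D'.toSourceTarget hs ht T) := by
    intro x y T
    induction T using BTensor.induction with
    | h0 => simp only [map_zero]
    | ht a b =>
      change BTensor.tmul _ _ (Φ (y * b)) (Φ (x * a)) = BTensor.tmul _ _ (Φ b * Φ y) (Φ a * Φ x)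
      rw [hΦ, antiAddEquiv_mul, antiAddEquiv_mul]
    | ha S T hS hT => simp only [map_add, hS, hT]
  have tak : ∀ a, ∀ r : L',
      D'.rightMul (D'.t (op r)) 1 (D'.comul a) = D'.rightMul 1 (D'.s r) (D'.comul a) := by
    intro a r
    obtain ⟨l, rfl⟩ := hφ r
    obtain ⟨a, rfl⟩ := Φ.surjective a
    have h1 : Φ 1 = 1 := antiAddEquiv_one Ψ
    have := congrArg (antiFlipRL φ Ψ D.toSourceTarget D'.toSourceTarget hs ht) (h.takeuchi a l)
    rw [hmul, hmul, h1] at this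
    rw [hγ, hs, op_unop, ht, this]
  refine ⟨?_, tak, ?_, ?_, ?_, ?_, ?_⟩
  · exact h.comonoid.antiTransport φ Φ _ _ hγ hπ
  · have h1 : Φ 1 = 1 := antiAddEquiv_one Ψ
    rw [← h1, hγ, h.comul_one]
    rfl
  · intro a b
    have key : ∀ T hT T' hT' W,
        T' = antiFlipRL φ Ψ D.toSourceTarget D'.toSourceTarget hs ht T →
        antiFlipRL φ Ψ D.toSourceTarget D'.toSourceTarget hs ht (D.tensorMulR T hT W) =
          D'.tensorMulL T' hT' (antiFlipRL φ Ψ D.toSourceTarget D'.toSourceTarget hs ht W) := by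
      rintro T hT T' hT' W rfl
      induction W using BTensor.induction with
      | h0 => simp only [map_zero]
      | ht x y => exact hmul x y T
      | ha S T hS hT => simp only [map_add, hS, hT]
    obtain ⟨a, rfl⟩ := Φ.surjective a
    obtain ⟨b, rfl⟩ := Φ.surjective b
    rw [hΦ, ← antiAddEquiv_mul, hγ, h.comul_mul, key _ _ _ (tak _) _ (hγ a), ← hγ b]
  · have h1 : Φ 1 = 1 := antiAddEquiv_one Ψ
    rw [← h1, hπ, h.counit_one, map_one, unop_one]
  · intro a b
    obtain ⟨a, rfl⟩ := Φ.surjective a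
    obtain ⟨b, rfl⟩ := Φ.surjective b
    rw [hπ b, hs, hΦ, ← antiAddEquiv_mul, ← antiAddEquiv_mul, hπ, hπ, h.counit_s_mul]
  · intro a b
    obtain ⟨a, rfl⟩ := Φ.surjective a
    obtain ⟨b, rfl⟩ := Φ.surjective b
    rw [hπ b, op_unop, ht, hΦ, ← antiAddEquiv_mul, ← antiAddEquiv_mul, hπ, hπ, h.counit_t_mul]

/-- The comultiplication of the opposite co-opposite is the flip transported along `op`. -/
theorem LeftBgdData.cop_opp_comul (D : LeftBgdData A L) (x : A) :
    D.cop.opp.comul (op x) = antiFlipLR (RingEquiv.opOp L) (RingEquiv.opOp A)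
      D.toSourceTarget D.cop.opp.toSourceTarget (fun _ => rfl) (fun _ => rfl) (D.comul x) := by
  change BTensor.lift (P := D.cop.bimodL) (Q := D.cop.bimodL) _
    (fun x l y => BTensor.balanced (P := D.cop.opp.bimodR) (Q := D.cop.opp.bimodR)
      (op x) l (op y))
    (BTensor.lift (P := D.bimodL) (Q := D.bimodL) _
      (fun x l y => (BTensor.balanced (P := D.cop.bimodL) (Q := D.cop.bimodL)
        y (op l) x).symm) (D.comul x)) = _
  generalize D.comul x = T
  induction T using BTensor.induction with
  | h0 => simp only [map_zero]
  | ht x y => rfl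
  | ha S T hS hT => simp only [map_add, hS, hT]

/-- The comultiplication of the co-opposite opposite is the flip transported along `op`. -/
theorem RightBgdData.opp_cop_comul (D : RightBgdData A L) (x : A) :
    D.opp.cop.comul (op x) = antiFlipRL (RingEquiv.opOp L) (RingEquiv.opOp A)
      D.toSourceTarget D.opp.cop.toSourceTarget (fun _ => rfl) (fun _ => rfl) (D.comul x) := by
  change BTensor.lift (P := D.opp.bimodL) (Q := D.opp.bimodL) _
    (fun x l y => (BTensor.balanced (P := D.opp.cop.bimodL) (Q := D.opp.cop.bimodL)
      y (op l) x).symm)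
    (BTensor.lift (P := D.bimodR) (Q := D.bimodR) _
      (fun x l y => BTensor.balanced (P := D.opp.bimodL) (Q := D.opp.bimodL)
        (op x) l (op y)) (D.comul x)) = _
  generalize D.comul x = T
  induction T using BTensor.induction with
  | h0 => simp only [map_zero]
  | ht x y => rfl
  | ha S T hS hT => simp only [map_add, hS, hT]

/-- The opposite of the co-opposite of a left bialgebroid is a right bialgebroid. -/
theorem IsLeftBialgebroid.cop_opp {D : LeftBgdData A L} (h : IsLeftBialgebroid D) :
    IsRightBialgebroid D.cop.opp :=
  h.antiTransport (RingEquiv.opOp L) (RingEquiv.opOp A) (fun _ => rfl) (fun _ => rfl)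
    D.cop_opp_comul (fun _ => rfl)

/-- The co-opposite of the opposite of a right bialgebroid is a left bialgebroid. -/
theorem IsRightBialgebroid.opp_cop {D : RightBgdData A L} (h : IsRightBialgebroid D) :
    IsLeftBialgebroid D.opp.cop :=
  h.antiTransport (RingEquiv.opOp L) (RingEquiv.opOp A) (fun _ => rfl) (fun _ => rfl)
    D.opp_cop_comul (fun _ => rfl)

end BialgebroidAntiTransport

/-! ### Depth two as a decomposition of the Frobenius form -/

namespace FrobeniusSystem

variable {N : Type u} {M : Type v} [Ring N] [Ring M] {f : N →+* M} (F : FrobeniusSystem f)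

/-- The map `M ⊗_N M → M`, `x ⊗ y ↦ x ψ(y b)`. -/
def pairRight (b : M) : ExtTensor f →+ M :=
  BTensor.lift
    (((AddMonoidHom.mul : M →+ M →+ M).compl₂ (f : N →+ M)).compl₂
      (F.ψ.comp (AddMonoidHom.mulRight b)))
    (fun x n y => by simp [mul_assoc, F.ψ_left])

@[simp] theorem pairRight_tmul (b x y : M) :
    F.pairRight b (BTensor.tmul (extBimod f) (extBimod f) x y) = x * f (F.ψ (y * b)) := rfl

/-- The map `M ⊗_N M → M`, `x ⊗ y ↦ ψ(a x) y`. -/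
def pairLeft (a : M) : ExtTensor f →+ M :=
  BTensor.lift
    ((AddMonoidHom.mul : M →+ M →+ M).comp ((f : N →+ M).comp
      (F.ψ.comp (AddMonoidHom.mulLeft a))))
    (fun x n y => by simp [← mul_assoc, F.ψ_right])

@[simp] theorem pairLeft_tmul (a x y : M) :
    F.pairLeft a (BTensor.tmul (extBimod f) (extBimod f) x y) = f (F.ψ (a * x)) * y := rfl

/-- A tensor in `M ⊗_N M` is recovered from its pairings with the quasibasis. -/
theorem sum_tmul_pairRight (X : ExtTensor f) :
    ∑ k, BTensor.tmul (extBimod f) (extBimod f) (F.pairRight (F.u k) X) (F.v k) = X := by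
  induction X using BTensor.induction with
  | h0 =>
    refine Finset.sum_eq_zero fun k _ => ?_
    rw [map_zero, ← BTensor.tmulHom_apply, map_zero]
    rfl
  | ht x y =>
    conv_rhs => rw [← F.quasi_left y, ← BTensor.tmulHom_apply, map_sum]
    exact Finset.sum_congr rfl fun k _ =>
      BTensor.balanced (P := extBimod f) (Q := extBimod f) x (F.ψ (y * F.u k)) (F.v k)
  | ha S T hS hT =>
    simp only [map_add, BTensor.add_tmul, Finset.sum_add_distrib, hS, hT]

theorem ext_pairRight {X Y : ExtTensor f} (h : ∀ b, F.pairRight b X = F.pairRight b Y) :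
    X = Y := by
  rw [← F.sum_tmul_pairRight X, ← F.sum_tmul_pairRight Y]
  simp only [h]

/-- For an `N`-central `X = x ⊗ y`, the endomorphism `b ↦ x ψ(y b)`. -/
def pairRightEnd (X : ExtTensor f) (hX : IsNCentral f X) : bimodEnd f :=
  bimodEnd.mk
    (AddMonoidHom.mk' (fun b => F.pairRight b X) (fun b b' => by
      clear hX
      induction X using BTensor.induction with
      | h0 => simp
      | ht x y => simp [mul_add]
      | ha S T hS hT => simp only [map_add, hS, hT]; abel))
    (fun n m => by
      have h1 : ∀ Y : ExtTensor f, F.pairRight m (extTensorRight f (f n) Y) =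
          F.pairRight (f n * m) Y := by
        intro Y
        induction Y using BTensor.induction with
        | h0 => simp
        | ht x y => exact congrArg (fun z => x * f (F.ψ z)) (mul_assoc y (f n) m)
        | ha S T hS hT => simp only [map_add, hS, hT]
      have h2 : ∀ Y : ExtTensor f, F.pairRight m (extTensorLeft f (f n) Y) =
          f n * F.pairRight m Y := by
        intro Y
        induction Y using BTensor.induction with
        | h0 => simp
        | ht x y => exact mul_assoc (f n) x _
        | ha S T hS hT => simp only [map_add, hS, hT, mul_add]
      exact (h1 X).symm.trans ((congrArg _ (hX n).symm).trans (h2 X)))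
    (fun n m => by
      change F.pairRight (m * f n) X = F.pairRight m X * f n
      clear hX
      induction X using BTensor.induction with
      | h0 => simp
      | ht x y => simp [← mul_assoc, F.ψ_right]
      | ha S T hS hT => simp only [map_add, hS, hT, add_mul])

/-- For an `N`-central `X = x ⊗ y`, the endomorphism `a ↦ ψ(a x) y`. -/
def pairLeftEnd (X : ExtTensor f) (hX : IsNCentral f X) : bimodEnd f :=
  bimodEnd.mk
    (AddMonoidHom.mk' (fun a => F.pairLeft a X) (fun a a' => by
      clear hX
      induction X using BTensor.induction with
      | h0 => simp
      | ht x y => simp [add_mul]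
      | ha S T hS hT => simp only [map_add, hS, hT]; abel))
    (fun n m => by
      change F.pairLeft (f n * m) X = f n * F.pairLeft m X
      clear hX
      induction X using BTensor.induction with
      | h0 => simp
      | ht x y => simp [mul_assoc, F.ψ_left]
      | ha S T hS hT => simp only [map_add, hS, hT, mul_add])
    (fun n m => by
      have h1 : ∀ Y : ExtTensor f, F.pairLeft m (extTensorLeft f (f n) Y) =
          F.pairLeft (m * f n) Y := by
        intro Y
        induction Y using BTensor.induction with
        | h0 => simp
        | ht x y => exact congrArg (fun z => f (F.ψ z) * y) (mul_assoc m (f n) x).symm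
        | ha S T hS hT => simp only [map_add, hS, hT]
      have h2 : ∀ Y : ExtTensor f, F.pairLeft m (extTensorRight f (f n) Y) =
          F.pairLeft m Y * f n := by
        intro Y
        induction Y using BTensor.induction with
        | h0 => simp
        | ht x y => exact (mul_assoc _ y (f n)).symm
        | ha S T hS hT => simp only [map_add, hS, hT, add_mul]
      exact (h1 X).symm.trans ((congrArg _ (hX n)).trans (h2 X)))

/-- Either depth two condition yields endomorphisms `a_i`, `b_i` with
`∑ a_i(m) b_i(m') = ψ(m m')`: pair the first factor of a left quasibasis, or the second factor
of a right one, with the Frobenius form. -/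
theorem exists_form_decomposition (h : HasLeftD2Quasibasis f ∨ HasRightD2Quasibasis f) :
    ∃ (k : ℕ) (a b : Fin k → bimodEnd f),
      ∀ m m', ∑ i, (a i).1 m * (b i).1 m' = f (F.ψ (m * m')) := by
  rcases h with ⟨k, X, β, hX, h⟩ | ⟨k, X, β, hX, h⟩
  · refine ⟨k, fun i => F.pairLeftEnd (X i) (hX i), β, fun m m' => ?_⟩
    have := congrArg (F.pairLeft m) (h m')
    rw [map_sum, pairLeft_tmul, mul_one] at this
    rw [← this]
    refine Finset.sum_congr rfl fun i _ => ?_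
    change F.pairLeft m (X i) * _ = _
    generalize X i = Y
    induction Y using BTensor.induction with
    | h0 => simp
    | ht x y => exact mul_assoc _ y _
    | ha S T hS hT => simp only [map_add, hS, hT, add_mul]
  · refine ⟨k, β, fun i => F.pairRightEnd (X i) (hX i), fun m m' => ?_⟩
    have := congrArg (F.pairRight m') (h m)
    rw [map_sum, pairRight_tmul, one_mul] at this
    rw [← this]
    refine Finset.sum_congr rfl fun i _ => ?_
    change _ * F.pairRight m' (X i) = _
    generalize X i = Y
    induction Y using BTensor.induction with
    | h0 => simp
    | ht x y => exact (mul_assoc _ x _).symm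
    | ha S T hS hT => simp only [map_add, hS, hT, mul_add]

/-! ### Evaluation of tensors over the centralizer -/

/-- The Casimir element `∑ u_i ⊗ v_i` commutes with `M`. -/
theorem sum_mul_tmul (x : M) :
    ∑ i, BTensor.tmul (extBimod f) (extBimod f) (x * F.u i) (F.v i) =
      ∑ i, BTensor.tmul (extBimod f) (extBimod f) (F.u i) (F.v i * x) := by
  refine F.ext_pairRight fun b => ?_
  simp only [map_sum, pairRight_tmul, mul_assoc, ← Finset.mul_sum, F.quasi_right]

/-- The endomorphism `m ↦ ∑ α(m u_i) β(v_i)`. -/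
def convolve (α β : bimodEnd f) : bimodEnd f :=
  bimodEnd.mk
    (∑ i, (AddMonoidHom.mulRight (β.1 (F.v i))).comp
      ((α.1 : M →+ M).comp (AddMonoidHom.mulRight (F.u i))))
    (fun n m => by
      simp only [AddMonoidHom.finsetSum_apply, Finset.mul_sum]
      refine Finset.sum_congr rfl fun i _ => ?_
      change α.1 (f n * m * F.u i) * _ = f n * (α.1 (m * F.u i) * _)
      rw [mul_assoc, α.2.1, mul_assoc])
    (fun n m => by
      simp only [AddMonoidHom.finsetSum_apply, Finset.sum_mul]
      let G : ExtTensor f →+ M := BTensor.lift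
        (((AddMonoidHom.mul : M →+ M →+ M).comp
          ((α.1 : M →+ M).comp (AddMonoidHom.mulLeft m))).compl₂ (β.1 : M →+ M))
        (fun x n y => by
          change α.1 (m * (x * f n)) * β.1 y = α.1 (m * x) * β.1 (f n * y)
          rw [← mul_assoc, α.2.2, β.2.1, mul_assoc])
      have h := congrArg G (F.sum_mul_tmul (f n))
      simp only [map_sum] at h
      refine Eq.trans (Finset.sum_congr rfl fun i _ => ?_)
        (h.trans (Finset.sum_congr rfl fun i _ => ?_))
      · change α.1 (m * f n * F.u i) * _ = α.1 (m * (f n * F.u i)) * _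
        rw [mul_assoc]
        rfl
      · change α.1 (m * F.u i) * β.1 (F.v i * f n) = α.1 (m * F.u i) * β.1 (F.v i) * f n
        rw [β.2.2, mul_assoc])

theorem convolve_apply (α β : bimodEnd f) (m : M) :
    (F.convolve α β).1 m = ∑ i, α.1 (m * F.u i) * β.1 (F.v i) := by
  change (∑ i, (AddMonoidHom.mulRight (β.1 (F.v i))).comp
      ((α.1 : M →+ M).comp (AddMonoidHom.mulRight (F.u i)))) m = _
  rw [AddMonoidHom.finsetSum_apply]
  rfl

/-- The additive map `A → L`, `x ↦ ∑ β(u_i) x(v_i)`. -/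
def coord (β : bimodEnd f) : bimodEnd f →+ extCentralizer f :=
  AddMonoidHom.mk' (fun x => leftCounit f (F.convolve β x)) (fun x y => by
    refine Subtype.ext ?_
    change (F.convolve β (x + y)).1 1 = (F.convolve β x).1 1 + (F.convolve β y).1 1
    simp only [convolve_apply, ← Finset.sum_add_distrib, ← mul_add]
    rfl)

theorem coe_coord (β x : bimodEnd f) :
    (F.coord β x : M) = ∑ i, β.1 (F.u i) * x.1 (F.v i) := by
  change (F.convolve β x).1 1 = _
  simp only [convolve_apply, one_mul]

/-- The map `A ⊗_L Y → M`, `x ⊗ y ↦ x(m) e(y)`, for a left `L`-linear `e : Y → M`. -/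
def evalTensor {Y : Type*} [AddCommGroup Y] (Q : BimodStr (extCentralizer f) Y) (e : Y →+ M)
    (he : ∀ c y, e (Q.l c y) = c * e y) (m : M) : BTensor (leftST f).bimodL Q →+ M :=
  BTensor.lift
    (((AddMonoidHom.mul : M →+ M →+ M).comp
      (AddMonoidHom.mk' (fun x : bimodEnd f => x.1 m) (fun _ _ => rfl))).compl₂ e)
    (fun x c y => by
      change x.1 m * c * e y = x.1 m * e (Q.l c y)
      rw [he, mul_assoc])

/-- A decomposition of the Frobenius form makes `A` finitely generated projective as a right
`L`-module, with coordinates that are combinations of evaluations. Evaluations that separate `Y`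
therefore also separate `A ⊗_L Y`. -/
theorem eq_zero_of_evalTensor {k : ℕ} {a b : Fin k → bimodEnd f}
    (hab : ∀ m m', ∑ i, (a i).1 m * (b i).1 m' = f (F.ψ (m * m')))
    {Y J : Type*} [AddCommGroup Y] (Q : BimodStr (extCentralizer f) Y) (e : J → Y →+ M)
    (he : ∀ j c y, e j (Q.l c y) = c * e j y) (hsep : ∀ y, (∀ j, e j y = 0) → y = 0)
    (T : BTensor (leftST f).bimodL Q) (hT : ∀ m j, evalTensor Q (e j) (he j) m T = 0) :
    T = 0 := by
  -- `x ⊗ y ↦ c_i(x) y`, where `x = ∑ a_i c_i(x)`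
  let coef : Fin k → BTensor (leftST f).bimodL Q →+ Y := fun i => BTensor.lift
    (AddMonoidHom.comp (N := AddMonoid.End Y) (AddMonoidHom.id (AddMonoid.End Y) : _ →+ (Y →+ Y))
      ((Q.l : extCentralizer f →+ AddMonoid.End Y).comp (F.coord (b i))))
    (fun x c y => by
      change Q.l (F.coord (b i) ((leftST f).t (op c) * x)) y = Q.l (F.coord (b i) x) (Q.l c y)
      have : F.coord (b i) ((leftST f).t (op c) * x) = F.coord (b i) x * c := by
        refine Subtype.ext ?_
        rw [Subring.coe_mul, coe_coord, coe_coord, Finset.sum_mul]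
        exact Finset.sum_congr rfl fun i _ => (mul_assoc _ _ _).symm
      rw [this, map_mul]
      rfl)
  have hcoord : ∀ x : bimodEnd f, ∑ i, (leftST f).bimodL.r (op (F.coord (b i) x)) (a i) = x := by
    intro x
    refine Subtype.ext (AddMonoidHom.ext fun m => ?_)
    rw [AddSubmonoidClass.coe_finsetSum]
    refine (AddMonoidHom.finsetSum_apply _ _ _).trans ?_
    change ∑ i, (a i).1 m * (F.coord (b i) x : M) = x.1 m
    simp only [coe_coord, Finset.mul_sum]
    rw [Finset.sum_comm]
    conv_rhs => rw [← F.quasi_left m, map_sum]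
    refine Finset.sum_congr rfl fun j _ => ?_
    rw [x.2.1, ← hab, Finset.sum_mul]
    exact Finset.sum_congr rfl fun i _ => (mul_assoc _ _ _).symm
  have hrec : ∀ T, ∑ i, BTensor.tmul (leftST f).bimodL Q (a i) (coef i T) = T := by
    intro T
    induction T using BTensor.induction with
    | h0 =>
      refine Finset.sum_eq_zero fun i _ => ?_
      rw [map_zero, ← BTensor.tmulHom_apply, map_zero]
    | ht x y =>
      conv_rhs => rw [← hcoord x]
      change _ = (BTensor.tmulHom _ _).flip y _
      rw [map_sum]
      exact Finset.sum_congr rfl fun i _ => (BTensor.balanced (a i) (F.coord (b i) x) y).symm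
    | ha S T hS hT =>
      simp only [map_add, BTensor.tmul_add, Finset.sum_add_distrib, hS, hT]
  -- coordinates are combinations of evaluations, so the evaluations of the coordinates are too
  have heval : ∀ i j T, e j (coef i T) =
      ∑ n, (b i).1 (F.u n) * evalTensor Q (e j) (he j) (F.v n) T := by
    intro i j T
    induction T using BTensor.induction with
    | h0 => simp
    | ht x y =>
      change e j (Q.l (F.coord (b i) x) y) = ∑ n, (b i).1 (F.u n) * (x.1 (F.v n) * e j y)
      rw [he, coe_coord, Finset.sum_mul]
      exact Finset.sum_congr rfl fun i _ => mul_assoc _ _ _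
    | ha S T hS hT => simp only [map_add, mul_add, Finset.sum_add_distrib, hS, hT]
  rw [← hrec T]
  refine Finset.sum_eq_zero fun i _ => ?_
  have : coef i T = 0 := hsep _ fun j => by simp [heval, hT]
  rw [this, ← BTensor.tmulHom_apply, map_zero]

end FrobeniusSystem

/-! ### The left bialgebroid -/

section LeftBialgebroid

variable {N : Type u} {M : Type v} [Ring N] [Ring M] {f : N →+* M} (F : FrobeniusSystem f)

@[simp] theorem leftEval_tmul (m m' : M) (x y : bimodEnd f) :
    leftEval f m m' (BTensor.tmul (leftST f).bimodL (leftST f).bimodL x y) = x.1 m * y.1 m' := rfl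

theorem leftEval_l (m m' : M) (c : extCentralizer f)
    (T : BTensor (leftST f).bimodL (leftST f).bimodL) :
    leftEval f m m' (((leftST f).bimodL.tensor (leftST f).bimodL).l c T) =
      c * leftEval f m m' T := by
  induction T using BTensor.induction with
  | h0 => simp only [map_zero, mul_zero]
  | ht x y => exact mul_assoc (c : M) _ _
  | ha S T hS hT => simp only [map_add, mul_add, hS, hT]

theorem leftEval_r (m m' : M) (c : extCentralizer f)
    (T : BTensor (leftST f).bimodL (leftST f).bimodL) :
    leftEval f m m' (((leftST f).bimodL.tensor (leftST f).bimodL).r (op c) T) =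
      leftEval f m m' T * c := by
  induction T using BTensor.induction with
  | h0 => simp only [map_zero, zero_mul]
  | ht x y => exact (mul_assoc _ _ (c : M)).symm
  | ha S T hS hT => simp only [map_add, add_mul, hS, hT]

theorem leftEval_rightMul (m m' : M) (x y : bimodEnd f)
    (T : BTensor (leftST f).bimodL (leftST f).bimodL) :
    leftEval f m m' ((leftST f).rightMul x y T) = leftEval f (x.1 m) (y.1 m') T := by
  induction T using BTensor.induction with
  | h0 => simp only [map_zero]
  | ht a b => rfl
  | ha S T hS hT => simp only [map_add, hS, hT]

variable {k : ℕ} {a b : Fin k → bimodEnd f}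
  (hab : ∀ m m', ∑ i, (a i).1 m * (b i).1 m' = f (F.ψ (m * m')))

include hab in
/-- Evaluations separate the tensors in `A_L ⊗ _L A`. -/
theorem FrobeniusSystem.leftEval_ext {S T : BTensor (leftST f).bimodL (leftST f).bimodL}
    (h : ∀ m m', leftEval f m m' S = leftEval f m m' T) : S = T := by
  refine sub_eq_zero.mp (F.eq_zero_of_evalTensor hab (leftST f).bimodL
    (fun m' => AddMonoidHom.mk' (fun x : bimodEnd f => x.1 m') (fun _ _ => rfl))
    (fun _ _ _ => rfl) (fun y hy => Subtype.ext (AddMonoidHom.ext hy)) _ fun m m' => ?_)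
  exact (map_sub (leftEval f m m') S T).trans (sub_eq_zero.mpr (h m m'))

include hab in
/-- The multiplicative decomposition `α(m m') = α₁(m) α₂(m')` of an endomorphism exists. -/
theorem FrobeniusSystem.exists_leftEval_eq (α : bimodEnd f) :
    ∃ T, ∀ m m', leftEval f m m' T = α.1 (m * m') := by
  -- Expand `α(m m')` with `m' = ∑ u_j ψ(v_j m')` and decompose the form.
  refine ⟨∑ i, BTensor.tmul _ _ (F.convolve α (a i)) (b i), fun m m' => ?_⟩
  simp only [map_sum, leftEval_tmul, F.convolve_apply, Finset.sum_mul]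
  rw [Finset.sum_comm]
  conv_rhs => rw [← F.quasi_right m', Finset.mul_sum, map_sum]
  refine Finset.sum_congr rfl fun j _ => ?_
  rw [← mul_assoc, α.2.2, ← hab, Finset.mul_sum]
  exact Finset.sum_congr rfl fun i _ => mul_assoc _ _ _

include hab in
/-- The decompositions depend additively on `α`, by their uniqueness. -/
theorem FrobeniusSystem.exists_leftComul :
    ∃ γ : bimodEnd f →+ BTensor (leftST f).bimodL (leftST f).bimodL,
      ∀ α m m', leftEval f m m' (γ α) = α.1 (m * m') := by
  choose γ hγ using F.exists_leftEval_eq hab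
  refine ⟨AddMonoidHom.mk' γ fun α β => F.leftEval_ext hab fun m m' => ?_, hγ⟩
  rw [map_add, hγ, hγ, hγ]
  rfl

include hab in
/-- In every axiom both sides have the same evaluations, and evaluations separate tensors. -/
theorem FrobeniusSystem.isLeftBialgebroid
    {γ : bimodEnd f →+ BTensor (leftST f).bimodL (leftST f).bimodL}
    (hγ : ∀ α m m', leftEval f m m' (γ α) = α.1 (m * m')) :
    IsLeftBialgebroid (leftData f γ) := by
  have ext : ∀ {S T : BTensor (leftST f).bimodL (leftST f).bimodL},
    (∀ m m', leftEval f m m' S = leftEval f m m' T) → S = T := F.leftEval_ext hab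
  have cl : ∀ c x, γ ((leftST f).bimodL.l c x) =
      ((leftST f).bimodL.tensor (leftST f).bimodL).l c (γ x) := fun c x => ext fun m m' => by
    rw [leftEval_l, hγ, hγ]
    rfl
  have cr : ∀ c x, γ ((leftST f).bimodL.r (op c) x) =
      ((leftST f).bimodL.tensor (leftST f).bimodL).r (op c) (γ x) := fun c x => ext fun m m' => by
    rw [leftEval_r, hγ, hγ]
    rfl
  have pl : ∀ c x, leftCounit f ((leftST f).bimodL.l c x) = c * leftCounit f x :=
    fun c x => rfl
  have pr : ∀ c x, leftCounit f ((leftST f).bimodL.r (op c) x) = leftCounit f x * c :=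
    fun c x => rfl
  have comonoid : IsComonoid (leftST f).bimodL γ (leftCounit f) := by
    refine ⟨cl, cr, pl, pr, fun x => ?_, fun x => ?_, fun x => ?_⟩
    · -- both sides evaluate to `x(m m' m'')`
      have he : ∀ (j : M × M) c y, leftEval f j.1 j.2
          (((leftST f).bimodL.tensor (leftST f).bimodL).l c y) = c * leftEval f j.1 j.2 y :=
        fun j => leftEval_l j.1 j.2
      have h1 : ∀ m (j : M × M) (T : BTensor (leftST f).bimodL (leftST f).bimodL) cr' h',
          FrobeniusSystem.evalTensor ((leftST f).bimodL.tensor (leftST f).bimodL)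
            (leftEval f j.1 j.2) (he j) m
            (BTensor.assoc (leftST f).bimodL (leftST f).bimodL (leftST f).bimodL
              (BTensor.map (P' := (leftST f).bimodL.tensor (leftST f).bimodL)
                (Q' := (leftST f).bimodL) γ (AddMonoidHom.id _) cr' h' T)) =
          leftEval f (m * j.1) j.2 T := by
        intro m j T cr' h'
        induction T using BTensor.induction with
        | h0 => simp only [map_zero]
        | ht x y =>
          have h2 : ∀ W : BTensor (leftST f).bimodL (leftST f).bimodL,
              FrobeniusSystem.evalTensor ((leftST f).bimodL.tensor (leftST f).bimodL)
                (leftEval f j.1 j.2) (he j) m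
                (BTensor.assoc (leftST f).bimodL (leftST f).bimodL (leftST f).bimodL
                  (BTensor.tmul ((leftST f).bimodL.tensor (leftST f).bimodL)
                    (leftST f).bimodL W y)) = leftEval f m j.1 W * y.1 j.2 := by
            intro W
            induction W using BTensor.induction with
            | h0 =>
              rw [← BTensor.tmulHom_apply, map_zero]
              simp only [AddMonoidHom.zero_apply, map_zero, zero_mul]
            | ht p q => exact (mul_assoc (p.1 m) (q.1 j.1) (y.1 j.2)).symm
            | ha S T hS hT => simp only [BTensor.add_tmul, map_add, add_mul, hS, hT]
          rw [BTensor.map_tmul, AddMonoidHom.id_apply, h2, hγ, leftEval_tmul]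
        | ha S T hS hT => simp only [map_add, hS, hT]
      have h3 : ∀ m (j : M × M) (T : BTensor (leftST f).bimodL (leftST f).bimodL) cl' h',
          FrobeniusSystem.evalTensor ((leftST f).bimodL.tensor (leftST f).bimodL)
            (leftEval f j.1 j.2) (he j) m
            (BTensor.map (P' := (leftST f).bimodL)
              (Q' := (leftST f).bimodL.tensor (leftST f).bimodL) (AddMonoidHom.id _) γ h' cl' T) =
          leftEval f m (j.1 * j.2) T := by
        intro m j T cl' h'
        induction T using BTensor.induction with
        | h0 => simp only [map_zero]
        | ht x y => exact congrArg (fun z => x.1 m * z) (hγ y j.1 j.2)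
        | ha S T hS hT => simp only [map_add, hS, hT]
      refine sub_eq_zero.mp (F.eq_zero_of_evalTensor hab _
        (fun j : M × M => leftEval f j.1 j.2) he (fun y hy => ext fun m m' => ?_) _
        fun m j => ?_)
      · rw [map_zero]
        exact hy (m, m')
      · rw [map_sub, h1, h3, hγ, hγ, mul_assoc, sub_self]
    · refine Subtype.ext (AddMonoidHom.ext fun m => ?_)
      conv_rhs => rw [← one_mul m]
      refine Eq.trans ?_ (hγ x 1 m)
      generalize γ x = T
      induction T using BTensor.induction with
      | h0 => simp only [map_zero]; rfl
      | ht x y => rfl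
      | ha S T hS hT =>
        simp only [map_add]
        exact congrArg₂ (· + ·) hS hT
    · refine Subtype.ext (AddMonoidHom.ext fun m => ?_)
      conv_rhs => rw [← mul_one m]
      refine Eq.trans ?_ (hγ x m 1)
      generalize γ x = T
      induction T using BTensor.induction with
      | h0 => simp only [map_zero]; rfl
      | ht x y => rfl
      | ha S T hS hT =>
        simp only [map_add]
        exact congrArg₂ (· + ·) hS hT
  refine ⟨comonoid, fun x c => ?_, ?_, fun x y => ?_, rfl, fun x y => ?_, fun x y => ?_⟩
  · refine ext fun m m' => ?_
    refine (leftEval_rightMul m m' _ _ _).trans (Eq.trans ?_ (leftEval_rightMul m m' _ _ _).symm)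
    refine (hγ x _ _).trans (Eq.trans ?_ (hγ x _ _).symm)
    exact congrArg x.1 (mul_assoc m (c : M) m')
  · exact ext fun m m' => hγ 1 m m'
  · refine ext fun m m' => (hγ (x * y) m m').trans ?_
    have key : ∀ hT T, leftEval f m m' ((leftST f).tensorMulL (γ x) hT T) =
        x.1 (leftEval f m m' T) := by
      intro hT T
      induction T using BTensor.induction with
      | h0 => simp only [map_zero]
      | ht p q => exact (leftEval_rightMul m m' p q _).trans (hγ x _ _)
      | ha S T hS hT => simp only [map_add, hS, hT]
    refine Eq.trans ?_ (key _ _).symm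
    exact congrArg x.1 (hγ y m m').symm
  · refine Subtype.ext (congrArg x.1 (?_ : (y.1 1) * 1 = y.1 1))
    exact mul_one _
  · refine Subtype.ext (congrArg x.1 (?_ : 1 * (y.1 1) = y.1 1))
    exact one_mul _

end LeftBialgebroid

/-! ### The antipode -/

namespace FrobeniusSystem

variable {N : Type u} {M : Type v} [Ring N] [Ring M] {f : N →+* M} (F : FrobeniusSystem f)

theorem ψ_antipode (α : bimodEnd f) (m m' : M) :
    F.ψ (m * (F.antipode α).1 m') = F.ψ (α.1 m * m') :=
  F.ψ_antipodeFun α m m'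

/-- The inverse transpose `m ↦ ∑ ψ(m α(u_i)) v_i`. -/
def antipodeInvFun (α : bimodEnd f) : M →+ M :=
  ∑ i, (AddMonoidHom.mulRight (F.v i)).comp ((f : N →+ M).comp
    (F.ψ.comp (AddMonoidHom.mulRight (α.1 (F.u i)))))

theorem antipodeInvFun_apply (α : bimodEnd f) (m : M) :
    F.antipodeInvFun α m = ∑ i, f (F.ψ (m * α.1 (F.u i))) * F.v i := by
  simp [antipodeInvFun, AddMonoidHom.finsetSum_apply]

theorem ψ_antipodeInvFun (α : bimodEnd f) (m m' : M) :
    F.ψ (F.antipodeInvFun α m * m') = F.ψ (m * α.1 m') := by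
  rw [antipodeInvFun_apply, Finset.sum_mul, map_sum]
  conv_rhs => rw [← F.quasi_right m', map_sum, Finset.mul_sum, map_sum]
  refine Finset.sum_congr rfl fun i _ => ?_
  rw [mul_assoc, F.ψ_left, α.2.2, ← mul_assoc, F.ψ_right]

/-- The inverse of the antipode. -/
def antipodeInv (α : bimodEnd f) : bimodEnd f :=
  bimodEnd.mk (F.antipodeInvFun α)
    (fun n m => F.ext_left fun x => by
      rw [ψ_antipodeInvFun, mul_assoc, mul_assoc, F.ψ_left, F.ψ_left, ψ_antipodeInvFun])
    (fun n m => F.ext_left fun x => by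
      rw [ψ_antipodeInvFun, mul_assoc, mul_assoc, ψ_antipodeInvFun, α.2.1])

theorem ψ_antipodeInv (α : bimodEnd f) (m m' : M) :
    F.ψ ((F.antipodeInv α).1 m * m') = F.ψ (m * α.1 m') :=
  F.ψ_antipodeInvFun α m m'

theorem antipode_antipodeInv (α : bimodEnd f) : F.antipode (F.antipodeInv α) = α :=
  Subtype.ext <| AddMonoidHom.ext fun m => F.ext_right fun x =>
    (F.ψ_antipode _ x m).trans (F.ψ_antipodeInv α x m)

theorem antipodeInv_antipode (α : bimodEnd f) : F.antipodeInv (F.antipode α) = α :=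
  Subtype.ext <| AddMonoidHom.ext fun m => F.ext_left fun x =>
    (F.ψ_antipodeInv _ m x).trans (F.ψ_antipode α m x)

/-- The antipode as an isomorphism `A ≃ A^op`; it is antimultiplicative because it is a
transposition. -/
def antipodeEquiv : bimodEnd f ≃+* (bimodEnd f)ᵐᵒᵖ where
  toFun α := op (F.antipode α)
  invFun α := F.antipodeInv (unop α)
  left_inv := F.antipodeInv_antipode
  right_inv α := unop_injective (F.antipode_antipodeInv (unop α))
  map_mul' α β := unop_injective <| Subtype.ext <| AddMonoidHom.ext fun m => F.ext_right fun x =>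
    ((F.ψ_antipode (α * β) x m).trans (F.ψ_antipode α (β.1 x) m).symm).trans
      (F.ψ_antipode β x _).symm
  map_add' α β := unop_injective <| Subtype.ext <| AddMonoidHom.ext fun m => F.ext_right fun x => by
    change F.ψ (x * (F.antipode (α + β)).1 m) =
      F.ψ (x * ((F.antipode α).1 m + (F.antipode β).1 m))
    rw [mul_add, map_add, ψ_antipode, ψ_antipode, ψ_antipode, ← map_add, ← add_mul]
    rfl

/-- The inverse antipode as an isomorphism `A ≃ A^op`. -/
def antipodeInvEquiv : bimodEnd f ≃+* (bimodEnd f)ᵐᵒᵖ :=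
  (RingEquiv.opOp (bimodEnd f)).trans (RingEquiv.op F.antipodeEquiv).symm

theorem antipode_leftMulHom (c : extCentralizer f) :
    F.antipode (leftMulHom f c) = rightMulHom f (op (F.nakayama.symm c)) :=
  Subtype.ext <| AddMonoidHom.ext fun m => F.ext_right fun x => by
    refine (F.ψ_antipode _ x m).trans ?_
    change F.ψ (c * x * m) = F.ψ (x * (m * F.nakayamaInvFun c))
    rw [← mul_assoc x, ψ_nakayamaInvFun, mul_assoc]

theorem antipode_rightMulHom (c : extCentralizer f) :
    F.antipode (rightMulHom f (op c)) = leftMulHom f c :=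
  Subtype.ext <| AddMonoidHom.ext fun m => F.ext_right fun x =>
    (F.ψ_antipode _ x m).trans (congrArg F.ψ (mul_assoc x (c : M) m))

theorem antipodeInv_leftMulHom (c : extCentralizer f) :
    F.antipodeInv (leftMulHom f c) = rightMulHom f (op c) := by
  rw [← antipode_rightMulHom, antipodeInv_antipode]

theorem antipodeInv_rightMulHom (c : extCentralizer f) :
    F.antipodeInv (rightMulHom f (op c)) = leftMulHom f (F.nakayama c) := by
  rw [← F.antipodeInv_antipode (leftMulHom f (F.nakayama c)), antipode_leftMulHom,
    RingEquiv.symm_apply_apply]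

theorem antipode_apply_one (α : bimodEnd f) : (F.antipode α).1 1 = F.rightCounitFun α :=
  F.ext_right fun x => by rw [ψ_antipode, ψ_rightCounitFun, mul_one]

theorem rightCounitFun_antipode (α : bimodEnd f) :
    F.rightCounitFun (F.antipode α) = F.nakayamaInvFun (leftCounit f α) :=
  F.ext_right fun x => by
    rw [ψ_rightCounitFun, ψ_nakayamaInvFun, ← one_mul ((F.antipode α).1 x), ψ_antipode]
    rfl

/-! ### The right bialgebroid -/

/-- The flip `x ⊗ y ↦ S⁻¹(y) ⊗ S⁻¹(x)`, from `A_L ⊗ _L A` to `A^R ⊗ ^R A`. -/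
def flipInv : BTensor (leftST f).bimodL (leftST f).bimodL →+
    BTensor F.rightST.bimodR F.rightST.bimodR :=
  antiFlipLR (RingEquiv.opOp (extCentralizer f)) F.antipodeInvEquiv (leftST f) F.rightST
    (fun c => (F.antipodeInv_leftMulHom c).symm) (fun c => (F.antipodeInv_rightMulHom c).symm)

@[simp] theorem flipInv_tmul (x y : bimodEnd f) :
    F.flipInv (BTensor.tmul (leftST f).bimodL (leftST f).bimodL x y) =
      BTensor.tmul F.rightST.bimodR F.rightST.bimodR (F.antipodeInv y) (F.antipodeInv x) := rfl

theorem flipInv_surjective : Function.Surjective F.flipInv := by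
  intro T
  induction T using BTensor.induction with
  | h0 => exact ⟨0, map_zero _⟩
  | ht x y =>
    exact ⟨BTensor.tmul _ _ (F.antipode y) (F.antipode x), by
      rw [flipInv_tmul, antipodeInv_antipode, antipodeInv_antipode]⟩
  | ha S T hS hT =>
    obtain ⟨S, rfl⟩ := hS
    obtain ⟨T, rfl⟩ := hT
    exact ⟨S + T, map_add _ _ _⟩

/-- `θ = ν⁻¹` as an isomorphism. -/
def thetaEquiv : extCentralizer f ≃+* (extCentralizer f)ᵐᵒᵖᵐᵒᵖ :=
  F.nakayama.symm.trans (RingEquiv.opOp (extCentralizer f))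

/-- The flip `x ⊗ y ↦ S(y) ⊗ S(x)`, from `A_L ⊗ _L A` to `A^R ⊗ ^R A`. -/
def flipAntipode : BTensor (leftST f).bimodL (leftST f).bimodL →+
    BTensor F.rightST.bimodR F.rightST.bimodR :=
  antiFlipLR F.thetaEquiv F.antipodeEquiv (leftST f) F.rightST
    (fun c => (F.antipode_leftMulHom c).symm)
    (fun c => by
      refine Eq.trans ?_ (F.antipode_rightMulHom c).symm
      exact congrArg (leftMulHom f) (F.nakayama.apply_symm_apply c))

@[simp] theorem flipAntipode_tmul (x y : bimodEnd f) :
    F.flipAntipode (BTensor.tmul (leftST f).bimodL (leftST f).bimodL x y) =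
      BTensor.tmul F.rightST.bimodR F.rightST.bimodR (F.antipode y) (F.antipode x) := rfl

/-- Contracting the second tensor factor moves `β` across the Frobenius form. -/
theorem pairRight_rightEval_tmul (b m : M) (α β : bimodEnd f) :
    F.pairRight b (F.rightEval m (BTensor.tmul F.rightST.bimodR F.rightST.bimodR α β)) =
      α.1 (m * (F.antipode β).1 b) := by
  change F.pairRight b (∑ i, BTensor.tmul (extBimod f) (extBimod f)
    (α.1 (m * F.u i)) (β.1 (F.v i))) = _
  simp only [map_sum, pairRight_tmul]
  conv_rhs => rw [← F.quasi_right ((F.antipode β).1 b), Finset.mul_sum, map_sum]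
  refine Finset.sum_congr rfl fun i _ => ?_
  rw [ψ_antipode, ← mul_assoc, α.2.2]

/-- Up to the nondegenerate pairings, evaluating `x ⊗ y ↦ S⁻¹(y) ⊗ S⁻¹(x)` on the right amounts
to evaluating `x ⊗ y` on the left. -/
theorem ψ_pairRight_rightEval_flipInv (b m m' : M)
    (W : BTensor (leftST f).bimodL (leftST f).bimodL) :
    F.ψ (F.pairRight b (F.rightEval m (F.flipInv W)) * m') = F.ψ (m * leftEval f b m' W) := by
  induction W using BTensor.induction with
  | h0 => simp only [map_zero, zero_mul, mul_zero]
  | ht x y =>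
    rw [flipInv_tmul, pairRight_rightEval_tmul, ψ_antipodeInv, antipode_antipodeInv, mul_assoc,
      leftEval_tmul]
  | ha S T hS hT => simp only [map_add, add_mul, mul_add, hS, hT]

/-- The analogue for the flip by `S`: pairing the right evaluation of `S(y) ⊗ S(x)` gives
`S(x)(y(m') m)`, whose expansion by the quasibasis involves only left evaluations of `x ⊗ y`. -/
theorem ψ_mul_pairRight_rightEval_flipAntipode (b m m' : M)
    (W : BTensor (leftST f).bimodL (leftST f).bimodL) :
    F.ψ (m' * F.pairRight b (F.rightEval m (F.flipAntipode W))) =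
      F.ψ ((∑ i, F.u i * f (F.ψ (leftEval f (F.v i) m' W * m))) * b) := by
  induction W using BTensor.induction with
  | h0 => simp only [map_zero, zero_mul, mul_zero, Finset.sum_const_zero]
  | ht x y =>
    rw [flipAntipode_tmul, pairRight_rightEval_tmul, ψ_antipode, ← mul_assoc, ψ_antipode]
    simp only [leftEval_tmul, mul_assoc (x.1 _)]
    rw [← F.antipodeFun_apply]
    rfl
  | ha S T hS hT =>
    simp only [map_add, add_mul, mul_add, Finset.sum_add_distrib, hS, hT]

/-- The flip by `S⁻¹` translates the characterization of `γ_L(S(α))` into that of `γ_R(α)`. -/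
theorem rightEval_flipInv_iff (α : bimodEnd f)
    (W : BTensor (leftST f).bimodL (leftST f).bimodL) :
    (∀ m, F.rightEval m (F.flipInv W) =
      ∑ i, BTensor.tmul (extBimod f) (extBimod f) (α.1 m * F.u i) (F.v i)) ↔
    ∀ m m', leftEval f m m' W = (F.antipode α).1 (m * m') := by
  have target : ∀ b m, F.pairRight b
      (∑ i, BTensor.tmul (extBimod f) (extBimod f) (α.1 m * F.u i) (F.v i)) = α.1 m * b := by
    intro b m
    simp only [map_sum, pairRight_tmul, mul_assoc, ← Finset.mul_sum, F.quasi_right]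
  constructor
  · refine fun h b m' => F.ext_right fun m => ?_
    rw [← ψ_pairRight_rightEval_flipInv, h, target, ψ_antipode, mul_assoc]
  · refine fun h m => F.ext_pairRight fun b => F.ext_left fun m' => ?_
    rw [ψ_pairRight_rightEval_flipInv, h, target, ψ_antipode, mul_assoc]

/-- The flip by `S` turns `γ_L(α)` into a tensor with the characterization of `γ_R(S(α))`. -/
theorem rightEval_flipAntipode (α : bimodEnd f)
    {W : BTensor (leftST f).bimodL (leftST f).bimodL}
    (hW : ∀ m m', leftEval f m m' W = α.1 (m * m')) (m : M) :
    F.rightEval m (F.flipAntipode W) =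
      ∑ i, BTensor.tmul (extBimod f) (extBimod f) ((F.antipode α).1 m * F.u i) (F.v i) := by
  refine F.ext_pairRight fun b => F.ext_right fun m' => ?_
  rw [ψ_mul_pairRight_rightEval_flipAntipode]
  simp only [hW, ← F.ψ_antipode, mul_assoc, F.quasi_right, map_sum, pairRight_tmul,
    ← Finset.mul_sum]

end FrobeniusSystem

theorem mainTheorem1 {N : Type u} {M : Type v} [Ring N] [Ring M] (f : N →+* M)
    (F : FrobeniusSystem f)
    (hD2 : HasLeftD2Quasibasis f ∨ HasRightD2Quasibasis f) :
    ∃ (γL : bimodEnd f →+ BTensor (leftST f).bimodL (leftST f).bimodL)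
      (γR : bimodEnd f →+ BTensor F.rightST.bimodR F.rightST.bimodR)
      (S : bimodEnd f ≃+* (bimodEnd f)ᵐᵒᵖ),
      (∀ α T, T = γL α ↔ ∀ m m', leftEval f m m' T = α.1 (m * m')) ∧
      (∀ α T, T = γR α ↔ ∀ m, F.rightEval m T =
        ∑ i, BTensor.tmul (extBimod f) (extBimod f) (α.1 m * F.u i) (F.v i)) ∧
      (∀ α, S α = op (F.antipode α)) ∧
      (∀ α m m', F.ψ (m * (F.antipode α).1 m') = F.ψ (α.1 m * m')) ∧
      IsLeftBialgebroid (leftData f γL) ∧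
      IsRightBialgebroid (F.rightData γR) ∧
      IsRightBialgebroidIso (F.rightData γR) (leftData f γL).cop.opp
        (S : bimodEnd f →+* (bimodEnd f)ᵐᵒᵖ) (RingHom.id (extCentralizer f)ᵐᵒᵖ) ∧
      IsLeftBialgebroidIso (leftData f γL) (F.rightData γR).opp.cop
        (S : bimodEnd f →+* (bimodEnd f)ᵐᵒᵖ) F.theta := by
  obtain ⟨k, a, b, hab⟩ := F.exists_form_decomposition hD2
  obtain ⟨γL, hL⟩ := F.exists_leftComul hab
  have hL' : ∀ α T, T = γL α ↔ ∀ m m', leftEval f m m' T = α.1 (m * m') := fun α T =>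
    ⟨fun h m m' => h ▸ hL α m m', fun h => F.leftEval_ext hab fun m m' => by rw [h, hL]⟩
  -- `γ_R = (S⁻¹ ⊗ S⁻¹) ∘ flip ∘ γ_L ∘ S`
  let γR : bimodEnd f →+ BTensor F.rightST.bimodR F.rightST.bimodR :=
    F.flipInv.comp (γL.comp (antiAddEquiv F.antipodeEquiv : bimodEnd f →+ bimodEnd f))
  have hγR : ∀ α, γR α = F.flipInv (γL (F.antipode α)) := fun _ => rfl
  have hR : ∀ α T, T = γR α ↔ ∀ m, F.rightEval m T =
      ∑ i, BTensor.tmul (extBimod f) (extBimod f) (α.1 m * F.u i) (F.v i) := by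
    intro α T
    constructor
    · rintro rfl
      exact (F.rightEval_flipInv_iff α _).mpr (hL _)
    · obtain ⟨W, rfl⟩ := F.flipInv_surjective T
      intro h
      rw [hγR, ← (hL' _ W).mpr ((F.rightEval_flipInv_iff α W).mp h)]
  have left := F.isLeftBialgebroid hab hL
  have right : IsRightBialgebroid (F.rightData γR) := by
    refine left.antiTransport (RingEquiv.opOp (extCentralizer f)) F.antipodeInvEquiv
      (fun c => (F.antipodeInv_leftMulHom c).symm) (fun c => (F.antipodeInv_rightMulHom c).symm)
      (fun x => ?_) (fun x => ?_)
    · change F.flipInv (γL (F.antipode (F.antipodeInv x))) = F.flipInv (γL x)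
      rw [F.antipode_antipodeInv]
    · refine unop_injective (Subtype.ext ?_)
      change F.rightCounitFun (F.antipodeInv x) = x.1 1
      rw [← F.antipode_apply_one, F.antipode_antipodeInv]
  have hS : ∀ α, (F.antipodeEquiv : bimodEnd f →+* (bimodEnd f)ᵐᵒᵖ) α = op (F.antipode α) :=
    fun _ => rfl
  refine ⟨γL, γR, F.antipodeEquiv, hL', hR, fun _ => rfl, F.ψ_antipode, left, right,
    ⟨right, left.cop_opp, fun c => ?_, fun c => ?_, fun α => ?_, fun α => ?_,
      F.antipodeEquiv.bijective, Function.bijective_id⟩,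
    ⟨left, right.opp_cop, fun c => ?_, fun c => ?_, fun α => ?_, fun α => ?_,
      F.antipodeEquiv.bijective, F.thetaEquiv.bijective⟩⟩
  · exact congrArg op (F.antipode_rightMulHom (unop c)).symm
  · refine congrArg op (Eq.trans ?_ (F.antipode_leftMulHom (F.nakayama (unop c))).symm)
    exact congrArg (fun d => rightMulHom f (op d)) (F.nakayama.symm_apply_apply (unop c)).symm
  · exact unop_injective (Subtype.ext (F.antipode_apply_one α))
  · rw [hS, LeftBgdData.cop_opp_comul]
    change antiFlipLR _ _ _ _ _ _ (γL (F.antipode α)) =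
      tensorHomR _ _ _ _ _ _ (F.flipInv (γL (F.antipode α)))
    generalize γL (F.antipode α) = T
    induction T using BTensor.induction with
    | h0 => simp only [map_zero]
    | ht x y =>
      change BTensor.tmul _ _ (op y) (op x) = BTensor.tmul _ _
        (op (F.antipode (F.antipodeInv y))) (op (F.antipode (F.antipodeInv x)))
      rw [F.antipode_antipodeInv, F.antipode_antipodeInv]
    | ha S T hS hT => simp only [map_add, hS, hT]
  · exact congrArg op (F.antipode_leftMulHom c).symm
  · refine congrArg op (Eq.trans ?_ (F.antipode_rightMulHom c).symm)
    exact congrArg (leftMulHom f) (F.nakayama.apply_symm_apply c)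
  · exact unop_injective (unop_injective (Subtype.ext (F.rightCounitFun_antipode α)))
  · have hflip : γR (F.antipode α) = F.flipAntipode (γL α) :=
      ((hR _ _).mpr (F.rightEval_flipAntipode α (hL α))).symm
    rw [hS, RightBgdData.opp_cop_comul]
    change antiFlipRL _ _ _ _ _ _ (γR (F.antipode α)) = tensorHomL _ _ _ _ _ _ (γL α)
    rw [hflip]
    generalize γL α = T
    induction T using BTensor.induction with
    | h0 => simp only [map_zero]
    | ht x y => rfl
    | ha S T hS hT => simp only [map_add, hS, hT]
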